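/- Let $(R,\mathfrak m)$ be a Noetherian local ring, $\mathfrak q$ an ideal with $\sqrt{\mathfrak q}=\mathfrak m$, and $M$ a finitely generated $R$-module of dimension $d\ge 2$ with $\operatorname{depth} M\ge d-1$. Let $\mathbb M=\{M_n\}_{n\ge 0}$ be a good $\mathfrak q$-filtration of $M$, i.e. $M=M_0\supseteq M_1\supseteq\cdots$ are submodules with $\mathfrak q M_n\subseteq M_{n+1}$ for all $n$ and $\mathfrak q M_n=M_{n+1}$ for $n\gg 0$. Write $\lambda$ for length. Then all $\lambda(M_n/M_{n+1})$ are finite and there is a unique polynomial $h(t)\in\mathbb Z[t]$ with $\sum_{n\ge0}\lambda(M_n/M_{n+1})t^n=h(t)/(1-t)^d$ and $h(1)\ne0$; put $e_2(\mathbb M)=h''(1)/2$. An element $a\in\mathfrak q$ is called $\mathbb M$-superficial for $\mathfrak q$ if there is $c\ge 0$ with $(M_{n+1}:_M a)\cap M_c=M_n$ for all $n\ge c$; a sequence $a_1,\dots,a_r$ is $\mathbb M$-superficial if each $a_i$ is superficial for the filtration $\{(M_n+N_i)/N_i\}_n$ of $M/N_i$, where $N_i=(a_1,\dots,a_{i-1})M$;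 it is maximal if $r=d$. Let $a_1,\dots,a_d$ be a maximal $\mathbb M$-superficial sequence for $\mathfrak q$, and let $J=(a_1,\dots,a_d)$ and $J_1=(a_1,\dots,a_{d-1})$. Then the sum $\sum_{n\ge1}n\,\lambda(M_{n+1}/JM_n)$ is finite and $$e_2(\mathbb M)\le\sum_{n\ge1}n\,\lambda(M_{n+1}/JM_n).$$ Moreover, equality holds if and only if $\operatorname{depth} gr_{\mathbb M}(M)\ge d-1$ and $(J_1M:_Ma_d)\cap M_1=J_1M$. Here $gr_{\mathbb M}(M)=\bigoplus_{n\ge0}M_n/M_{n+1}$ is regarded as a module over $gr_{\mathfrak q}(R)=\bigoplus_{n\ge0}\mathfrak q^n/\mathfrak q^{n+1}$, and its depth is taken with respect to the homogeneous maximal ideal $\mathfrak m/\mathfrak q\oplus\bigoplus_{n\ge1}\mathfrak q^n/\mathfrak q^{n+1}$. -/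

import Mathlib

open Polynomial IsLocalRing

noncomputable section

/-- The depth of `M` with respect to an ideal `I`: the supremum of the lengths of the
`M`-regular sequences contained in `I`. -/
def moduleDepth {A : Type*} [CommRing A] (I : Ideal A) (M : Type*) [AddCommGroup M]
    [Module A M] : ℕ∞ :=
  ⨆ rs : {rs : List A // RingTheory.Sequence.IsRegular M rs ∧ ∀ r ∈ rs, r ∈ I},
    (rs.1.length : ℕ∞)

/-- The length of the quotient `N / N'` (used for submodules `N' ≤ N`). -/
def quotLength {A : Type*} [CommRing A] {M : Type*} [AddCommGroup M] [Module A M]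
    (N N' : Submodule A M) : ℕ∞ :=
  Module.length A (N ⧸ N'.submoduleOf N)

namespace Ideal.Filtration

variable {R : Type*} [CommRing R] {M : Type*} [AddCommGroup M] [Module R M] {q : Ideal R}

/-- A good `q`-filtration of `M`: it starts from `M` and `q M_n = M_{n+1}` for all large `n`. -/
structure IsGood (F : q.Filtration M) : Prop where
  zero_eq_top : F.N 0 = ⊤
  stable : F.Stable

/-! ### Hilbert series and Hilbert coefficients -/

/-- The Hilbert function `n ↦ λ(M_n / M_{n+1})`. -/
def hilbertFunction (F : q.Filtration M) (n : ℕ) : ℕ∞ := quotLength (F.N n) (F.N (n + 1))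

/-- The Hilbert series `∑ λ(M_n / M_{n+1}) t ^ n` (meaningful when all the lengths are finite). -/
def hilbertSeries (F : q.Filtration M) : PowerSeries ℤ :=
  PowerSeries.mk fun n => ((F.hilbertFunction n).toNat : ℤ)

/-- `h` is the `h`-polynomial of the filtration of a module of dimension `d`: the Hilbert series
equals `h(t) / (1 - t) ^ d`, and `h(1) ≠ 0`. -/
def IsHPolynomial (F : q.Filtration M) (d : ℕ) (h : ℤ[X]) : Prop :=
  (h : PowerSeries ℤ) = F.hilbertSeries * (1 - PowerSeries.X) ^ d ∧ h.eval 1 ≠ 0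

open Classical in
/-- The `h`-polynomial (it is unique when it exists; the value is `0` if there is none). -/
def hPolynomial (F : q.Filtration M) (d : ℕ) : ℤ[X] :=
  if hh : ∃ h, F.IsHPolynomial d h then hh.choose else 0

/-- The Hilbert coefficient `e_i = h⁽ⁱ⁾(1) / i! = ∑ k, (k choose i) h_k`; the Hasse derivative
is the `i`-th derivative divided by `i!`. -/
def hilbertCoeff (F : q.Filtration M) (d i : ℕ) : ℤ :=
  (Polynomial.hasseDeriv i (F.hPolynomial d)).eval 1

/-! ### Superficial sequences -/

/-- The filtration `(M_n + N) / N` induced on the quotient `M / N`. -/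
def quotient (F : q.Filtration M) (N : Submodule R M) : q.Filtration (M ⧸ N) where
  N n := (F.N n).map N.mkQ
  mono n := Submodule.map_mono (F.mono n)
  smul_le n := by
    rw [← Submodule.map_smul'']
    exact Submodule.map_mono (F.smul_le n)

/-- `a ∈ q` is superficial for the filtration: there is `c` with
`(M_{n+1} :_M a) ∩ M_c = M_n` for all `n ≥ c`. -/
def IsSuperficial (F : q.Filtration M) (a : R) : Prop :=
  a ∈ q ∧ ∃ c : ℕ, ∀ n ≥ c, (F.N (n + 1)).comap (LinearMap.lsmul R M a) ⊓ F.N c = F.N n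

/-- `a_1, …, a_r` is a superficial sequence: each `a_i` is superficial for the filtration
induced on `M / (a_1, …, a_{i-1}) M`. -/
def IsSuperficialSeq (F : q.Filtration M) {r : ℕ} (a : Fin r → R) : Prop :=
  ∀ i : Fin r,
    (F.quotient (Ideal.span (a '' {j | j < i}) • (⊤ : Submodule R M))).IsSuperficial (a i)

/-! ### The associated graded ring and the associated graded module -/

/-- The Rees ring `R[qt] = ⨁ qⁿ tⁿ ⊆ R[t]`. -/
def _root_.Ideal.Rees (q : Ideal R) : Type _ := reesAlgebra q

instance (q : Ideal R) : CommRing q.Rees := inferInstanceAs (CommRing (reesAlgebra q))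

instance (q : Ideal R) : Algebra R q.Rees := inferInstanceAs (Algebra R (reesAlgebra q))

/-- The constant coefficient `R[qt] → R`. -/
def _root_.Ideal.reesConstantCoeff (q : Ideal R) : q.Rees →+* R :=
  constantCoeff.comp (reesAlgebra q).val.toRingHom

/-- The Rees module `⨁ M_n tⁿ ⊆ M[t]`. -/
def Rees (F : q.Filtration M) : Type _ := F.submodule

instance (F : q.Filtration M) : AddCommGroup F.Rees := inferInstanceAs (AddCommGroup F.submodule)

/-- The action of the Rees ring on the Rees module: the one induced by that of `R[t]` on `M[t]`. -/
instance (F : q.Filtration M) : Module q.Rees F.Rees :=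
  inferInstanceAs (Module (reesAlgebra q) F.submodule)

/-- The associated graded ring `gr_q(R) = ⨁ qⁿ / qⁿ⁺¹`, as `R[qt] / q R[qt]`. -/
abbrev _root_.Ideal.Gr (q : Ideal R) : Type _ := q.Rees ⧸ q.map (algebraMap R q.Rees)

/-- The homogeneous maximal ideal `𝔪 / q ⊕ ⨁_{n ≥ 1} qⁿ / qⁿ⁺¹` of `gr_q(R)`, for `R` local and
`q ⊆ 𝔪`: the classes of those `f ∈ R[qt]` whose constant coefficient lies in `𝔪`. -/
def _root_.Ideal.grMaximalIdeal [IsLocalRing R] (q : Ideal R) : Ideal q.Gr :=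
  ((maximalIdeal R).comap q.reesConstantCoeff).map
    (Ideal.Quotient.mk (q.map (algebraMap R q.Rees)))

/-- The submodule `⨁ M_{n+1} tⁿ` of the Rees module `⨁ M_n tⁿ`. -/
def reesShift (F : q.Filtration M) : Submodule q.Rees F.Rees where
  carrier := {f | ∀ n, (f.1 : PolynomialModule R M).coeff n ∈ F.N (n + 1)}
  add_mem' hf hg n := (F.N (n + 1)).add_mem (hf n) (hg n)
  zero_mem' n := (F.N (n + 1)).zero_mem
  smul_mem' r _ hf :=
    let F' : q.Filtration M :=
      ⟨fun n => F.N (n + 1), fun n => F.mono (n + 1), fun n => F.smul_le (n + 1)⟩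
    F'.submodule.smul_mem r hf

/-- The associated graded module `⨁ M_n / M_{n+1}`, as the quotient of the Rees module
`⨁ M_n tⁿ` by `⨁ M_{n+1} tⁿ`. -/
abbrev Gr (F : q.Filtration M) : Type _ := F.Rees ⧸ F.reesShift

theorem gr_isTorsionBySet (F : q.Filtration M) :
    Module.IsTorsionBySet q.Rees F.Gr (q.map (algebraMap R q.Rees) : Ideal q.Rees) := by
  refine (Module.isTorsionBySet_iff_is_torsion_by_span _).mp ?_
  rintro x ⟨_, r, hr, rfl⟩
  obtain ⟨f, rfl⟩ := Submodule.Quotient.mk_surjective _ x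
  change Submodule.Quotient.mk (algebraMap R q.Rees r • f) = _
  rw [Submodule.Quotient.mk_eq_zero]
  intro i
  change ((monomial 0 r : R[X]) • (f.1 : PolynomialModule R M)).coeff i ∈ _
  rw [PolynomialModule.monomial_smul_apply]
  simpa using F.smul_le i (Submodule.smul_mem_smul hr (f.2 i))

/-- The associated graded module is a module over `gr_q(R)`, through the action of the Rees
ring. -/
instance (F : q.Filtration M) : Module q.Gr F.Gr :=
  Module.IsTorsionBySet.module F.gr_isTorsionBySet

/-- The depth of the associated graded module over `gr_q(R)`, with respect to the homogeneous
maximal ideal of `gr_q(R)`. -/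
def grDepth [IsLocalRing R] (F : q.Filtration M) : ℕ∞ :=
  moduleDepth q.grMaximalIdeal F.Gr

end Ideal.Filtration

end

/-! Index the sequence from zero as x_0, …, x_{d-1}, let N_i = (x_0, …, x_{i-1})M, and let H_i be
the Hilbert series of the filtration induced on M/N_i. Modulo N_i, whatever is killed by the
superficial element x_i is killed by a power of q, so depth M ≥ d-1 forces x_0, …, x_{d-2} to be
M-regular. Then for i ≤ d-2 the colon defect U_i = ∑ λ((N_i + M_{n+1} : x_i)/(N_i + M_n)) t^n is a
polynomial, and H_{i+1} = (1-t)(H_i + U_i).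

Put N = N_{d-1} and b = x_{d-1}. The module M/N has dimension one, and a length count gives
(1-t)H_{d-1} = e - (1-t)(V - W) with e ≠ 0, where V_n = λ(M_{n+1}/(M_{n+1} ∩ (N + bM_n))) and W_n =
λ(((N : b) ∩ (N + M_n))/N). Hence h = e - (1-t)(V - W) - (1-t)²T with T(1) = U_{d-2}(1), and the
second Taylor coefficient at 1 is e_2 = V'(1) - W'(1) - U_{d-2}(1). As JM_n ⊆ M_{n+1} ∩ (N + bM_n),
V'(1) is at most the sum S in question. So S - e_2 is a sum of three nonnegative terms.

Equality makes all three vanish. W_n = 0 for n ≥ 1 is the condition (N : b) ∩ M_1 = N. U_{d-2} = 0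
says that the initial form of x_{d-2} is regular modulo N_{d-2}; Sally's descent
(`IsSuperficial.comap_le_of_comap_le`) carries this to all earlier x_i, which is depth gr ≥ d-1
(`IsGood.le_grDepth_iff`). Conversely, under these colon conditions the Valabrega–Valla property
(`inf_partialSpan_smul_top_le`) gives M_{n+1} ∩ (N + bM_n) = JM_n, so the remaining term vanishes
too. -/

noncomputable section

/-! ### Lengths of quotients -/

section Length

variable {R : Type*} [CommRing R] {M : Type*} [AddCommGroup M] [Module R M]

theorem length_quotient_eq_add {P' P : Submodule R M} (h : P' ≤ P) :
    Module.length R (M ⧸ P') = quotLength P P' + Module.length R (M ⧸ P) := by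
  have hle : P'.submoduleOf P ≤ P'.comap P.subtype := le_rfl
  refine Module.length_eq_add_of_exact ((P'.submoduleOf P).mapQ P' P.subtype hle)
    (Submodule.factor h) ?_ (Submodule.factor_surjective h) ?_
  · rw [← LinearMap.ker_eq_bot, Submodule.ker_mapQ]
    exact (Submodule.mkQ_map_self _)
  · intro y
    obtain ⟨y, rfl⟩ := Submodule.Quotient.mk_surjective _ y
    constructor
    · intro hy
      have hy' : y ∈ P := by simpa [Submodule.factor] using hy
      exact ⟨Submodule.Quotient.mk ⟨y, hy'⟩, rfl⟩
    · rintro ⟨z, hz⟩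
      obtain ⟨z, rfl⟩ := Submodule.Quotient.mk_surjective _ z
      rw [← hz]
      change Submodule.Quotient.mk (z : M) = 0
      simp

theorem quotLength_eq_zero_iff {P' P : Submodule R M} (h : P' ≤ P) :
    quotLength P P' = 0 ↔ P = P' := by
  unfold quotLength
  rw [Module.length_eq_zero_iff, Submodule.Quotient.subsingleton_iff, Submodule.submoduleOf_eq_top]
  exact ⟨fun h' => le_antisymm h' h, fun h' => h'.le⟩

theorem quotLength_inf (P Q : Submodule R M) : quotLength P (P ⊓ Q) = quotLength (P ⊔ Q) Q := by
  have : (P ⊓ Q).submoduleOf P = Q.submoduleOf P := by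
    ext x; simp [Submodule.submoduleOf]
  unfold quotLength
  rw [this]
  have := (LinearMap.quotientInfEquivSupQuotient P Q).length_eq
  rwa [← Submodule.comap_inf, ← Submodule.submoduleOf, ‹(P ⊓ Q).submoduleOf P = _›] at this

theorem quotLength_anti {P P' P'' : Submodule R M} (h : P'' ≤ P') :
    quotLength P P' ≤ quotLength P P'' :=
  Module.length_le_of_surjective
    (Submodule.factor (Submodule.comap_mono h : P''.submoduleOf P ≤ P'.submoduleOf P))
    (Submodule.factor_surjective _)

theorem quotLength_le_length_quotient {P' P : Submodule R M} (h : P' ≤ P) :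
    quotLength P P' ≤ Module.length R (M ⧸ P') := by
  rw [length_quotient_eq_add h]; exact le_self_add

theorem length_quotient_anti {P' P : Submodule R M} (h : P' ≤ P) :
    Module.length R (M ⧸ P) ≤ Module.length R (M ⧸ P') := by
  rw [length_quotient_eq_add h]; exact le_add_self

/-- Additivity of length along 0 → M/(B : b) → M/B → M/(B + bM) → 0, the first map being
multiplication by b. -/
theorem length_quotient_colon (B : Submodule R M) (b : R) :
    Module.length R (M ⧸ B) = Module.length R (M ⧸ B.comap (LinearMap.lsmul R M b)) +
      Module.length R (M ⧸ (B ⊔ Ideal.span {b} • (⊤ : Submodule R M))) := by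
  refine Module.length_eq_add_of_exact
    ((B.comap (LinearMap.lsmul R M b)).mapQ B (LinearMap.lsmul R M b) le_rfl)
    (Submodule.factor le_sup_left) ?_ (Submodule.factor_surjective _) ?_
  · rw [← LinearMap.ker_eq_bot, Submodule.ker_mapQ]
    exact (Submodule.mkQ_map_self _)
  · intro y
    obtain ⟨y, rfl⟩ := Submodule.Quotient.mk_surjective _ y
    constructor
    · intro hy
      have hy' : y ∈ B ⊔ Ideal.span {b} • (⊤ : Submodule R M) := by
        simpa [Submodule.factor] using hy
      obtain ⟨z, hz, w, hw, rfl⟩ := Submodule.mem_sup.mp hy'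
      rw [Submodule.ideal_span_singleton_smul] at hw
      obtain ⟨m, -, rfl⟩ := hw
      refine ⟨Submodule.Quotient.mk m, ?_⟩
      change Submodule.Quotient.mk (b • m) = _
      rw [eq_comm, Submodule.Quotient.eq]
      simpa using hz
    · rintro ⟨z, hz⟩
      obtain ⟨z, rfl⟩ := Submodule.Quotient.mk_surjective _ z
      rw [← hz]
      change Submodule.Quotient.mk (b • z) = 0
      rw [Submodule.Quotient.mk_eq_zero]
      exact Submodule.mem_sup_right
        (Submodule.smul_mem_smul (Ideal.mem_span_singleton_self b) trivial)

/-- The source of every comparison of Hilbert functions below. It is used with A = N + M_n and with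
B = N + M_{n+1} or B = N + bM_n. -/
theorem length_quotient_sup_add {A B : Submodule R M} {b : R}
    (h : A ≤ B.comap (LinearMap.lsmul R M b)) :
    Module.length R (M ⧸ (B ⊔ Ideal.span {b} • (⊤ : Submodule R M))) + Module.length R (M ⧸ A) =
      Module.length R (M ⧸ B) + quotLength (B.comap (LinearMap.lsmul R M b)) A := by
  rw [length_quotient_colon B b, length_quotient_eq_add h]
  abel

end Length
-- Regular sequences and depth
section RegularSequence
open RingTheory.Sequence
variable {A : Type*} [CommRing A] {M : Type*} [AddCommGroup M] [Module A M]

theorem exists_isRegular_of_le_moduleDepth {I : Ideal A} {n : ℕ} (hn : 0 < n)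
    (h : (n : ℕ∞) ≤ moduleDepth I M) :
    ∃ rs : List A, n ≤ rs.length ∧ (∀ r ∈ rs, r ∈ I) ∧ IsRegular M rs := by
  by_contra! hc
  have : moduleDepth I M ≤ ((n - 1 : ℕ) : ℕ∞) := by
    refine iSup_le fun ⟨rs, hrs, hmem⟩ => ?_
    have : ¬ n ≤ rs.length := fun hle => hc rs hle hmem hrs
    exact_mod_cast (by omega : rs.length ≤ n - 1)
  have := h.trans this
  norm_cast at this
  omega

theorem isRegular_take {rs : List A} (h : IsRegular M rs) (n : ℕ) : IsRegular M (rs.take n) := by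
  have h1 := h.1
  rw [← List.take_append_drop n rs, isWeaklyRegular_append_iff] at h1
  refine ⟨h1.1, fun htop => h.2 ?_⟩
  refine le_antisymm (htop.le.trans (Submodule.smul_mono_left (Ideal.span_mono ?_))) le_top
  exact fun r hr => List.mem_of_mem_take hr

end RegularSequence

section Depth
open CategoryTheory Abelian RingTheory.Sequence
universe u v
variable {A : Type u} [CommRing A] [IsNoetherianRing A] {M : Type v} [AddCommGroup M] [Module A M]
  [Module.Finite A M]

/-- Passing to M/xM costs at most one unit of depth, by the characterization of depth through
vanishing of Ext(A/I, -). -/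
theorem exists_isRegular_quotSMulTop (I : Ideal A) (hI : I • (⊤ : Submodule A M) ≠ ⊤) {x : A}
    (hx : x ∈ I) (hreg : IsSMulRegular M x) {n : ℕ}
    (h : ∃ rs : List A, rs.length = n + 1 ∧ (∀ r ∈ rs, r ∈ I) ∧ IsRegular M rs) :
    ∃ rs : List A, rs.length = n ∧ (∀ r ∈ rs, r ∈ I) ∧ IsRegular (QuotSMulTop x M) rs := by
  -- The Ext criterion wants a module whose universe also accommodates the ring, hence the lift.
  let M' : ModuleCat.{max u v} A := ModuleCat.of A (ULift.{max u v} M)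
  let e : M' ≃ₗ[A] M := ULift.moduleEquiv
  have : Module.Finite A M' := Module.Finite.equiv e.symm
  have hreg' : IsSMulRegular M' x := (e.isSMulRegular_congr x).mpr hreg
  have hI' : I • (⊤ : Submodule A M') < ⊤ := by
    refine lt_top_iff_ne_top.mpr fun h' => hI ?_
    have := congrArg (Submodule.map e.toLinearMap) h'
    simpa [Submodule.map_smul''] using this
  have hI'' : I • (⊤ : Submodule A (QuotSMulTop x M')) < ⊤ := by
    refine lt_top_iff_ne_top.mpr fun eq => hI'.ne ?_
    have := congrArg (Submodule.comap (Submodule.mkQ _)) eq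
    simpa [Submodule.comap_smul_top_of_surjective I _ (Submodule.mkQ_surjective _),
      Submodule.smul_mono_left ((Ideal.span_singleton_le_iff_mem I).mpr hx),
      ← Submodule.ideal_span_singleton_smul] using this
  obtain ⟨rs, hlen, hmem, hrs⟩ := h
  have hext := ((ModuleCat.exists_isRegular_tfae I (n + 1) M' hI').out 3 1 rfl rfl).mp
    ⟨rs, hlen, hmem, (e.isRegular_congr rs).mpr hrs⟩
  -- In the long exact sequence of 0 → M → M → M/xM → 0, Ext^i(A/I, M/xM) lies between Ext^i(A/I, M)
  -- and Ext^{i+1}(A/I, M).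
  have hext' : ∀ i < n, Subsingleton
      (Ext (ModuleCat.of A (Shrink.{max u v} (A ⧸ I))) (ModuleCat.of A (QuotSMulTop x M')) i) := by
    intro i hi
    have zero1 := AddCommGrpCat.isZero_of_iff_subsingleton.mpr (hext i (by omega))
    have zero2 := AddCommGrpCat.isZero_of_iff_subsingleton.mpr (hext (i + 1) (by omega))
    exact AddCommGrpCat.subsingleton_of_isZero <| ShortComplex.Exact.isZero_of_both_zeros
      ((Ext.covariant_sequence_exact₃' _ hreg'.smulShortComplex_shortExact) i (i + 1) rfl)
      (zero1.eq_zero_of_src _) (zero2.eq_zero_of_tgt _)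
  obtain ⟨ss, hslen, hsmem, hss⟩ := ((ModuleCat.exists_isRegular_tfae I n
    (ModuleCat.of A (QuotSMulTop x M')) hI'').out 3 1 rfl rfl).mpr hext'
  exact ⟨ss, hslen, hsmem, ((QuotSMulTop.congr x e).isRegular_congr ss).mp hss⟩

/-- Each term of `xs` uses up at most one unit of depth, so one unit is left over after all of them.
-/
theorem exists_isSMulRegular_quotient_ofList (I : Ideal A) (hI : I • (⊤ : Submodule A M) ≠ ⊤)
    {xs : List A} (hxs : ∀ x ∈ xs, x ∈ I) (hreg : IsWeaklyRegular M xs)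
    (h : ∃ rs : List A, rs.length = xs.length + 1 ∧ (∀ r ∈ rs, r ∈ I) ∧ IsRegular M rs) :
    ∃ y ∈ I, IsSMulRegular (M ⧸ (Ideal.ofList xs • ⊤ : Submodule A M)) y := by
  induction xs generalizing M with
  | nil =>
    obtain ⟨rs, hlen, hmem, hrs⟩ := h
    match rs, hlen with
    | [y], _ =>
      refine ⟨y, hmem y (by simp), ?_⟩
      have := (isRegular_cons_iff M y []).mp hrs |>.1
      rw [Ideal.ofList_nil, Submodule.bot_smul]
      exact ((Submodule.quotEquivOfEqBot (⊥ : Submodule A M) rfl).isSMulRegular_congr y).mpr this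
  | cons x xs ih =>
    have hx := hxs x (by simp)
    rw [isWeaklyRegular_cons_iff] at hreg
    have hI' : I • (⊤ : Submodule A (QuotSMulTop x M)) ≠ ⊤ := by
      refine fun eq => hI ?_
      have := congrArg (Submodule.comap (Submodule.mkQ _)) eq
      simpa [Submodule.comap_smul_top_of_surjective I _ (Submodule.mkQ_surjective _),
        Submodule.smul_mono_left ((Ideal.span_singleton_le_iff_mem I).mpr hx),
        ← Submodule.ideal_span_singleton_smul] using this
    obtain ⟨y, hy, hyreg⟩ := ih hI' (fun z hz => hxs z (by simp [hz])) hreg.2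
      (exists_isRegular_quotSMulTop I hI hx hreg.1 h)
    exact ⟨y, hy, ((Submodule.quotOfListConsSMulTopEquivQuotSMulTopInner M x xs).isSMulRegular_congr
      y).mpr hyreg⟩

/-- If `I` contains an `M`-regular sequence longer than the `M`-regular sequence `xs` of elements of
`I`, then every `x` that is regular on `M ⧸ xs M` up to elements killed by a power of `I` is
regular on it. -/
theorem isSMulRegular_of_pow_mul_le {I : Ideal A} (hI : I • (⊤ : Submodule A M) ≠ ⊤)
    {n : ℕ} (hn : (n : ℕ∞) ≤ moduleDepth I M) {xs : List A} (hxs : ∀ x ∈ xs, x ∈ I)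
    (hreg : IsWeaklyRegular M xs) (hlen : xs.length < n) {x : A}
    (hx : ∃ s, ∀ y ∈ I, ∀ m : M ⧸ (Ideal.ofList xs • ⊤ : Submodule A M), x • m = 0 → y ^ s • m = 0) :
    IsSMulRegular (M ⧸ (Ideal.ofList xs • ⊤ : Submodule A M)) x := by
  obtain ⟨rs, hrl, hrm, hrs⟩ := exists_isRegular_of_le_moduleDepth (by omega) hn
  obtain ⟨y, hy, hyreg⟩ := exists_isSMulRegular_quotient_ofList I hI hxs hreg
    ⟨rs.take (xs.length + 1), by simp; omega, fun r hr => hrm r (List.mem_of_mem_take hr),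
      isRegular_take hrs _⟩
  obtain ⟨s, hs⟩ := hx
  refine (isSMulRegular_iff_right_eq_zero_of_smul).mpr fun m hm => ?_
  exact (isSMulRegular_iff_right_eq_zero_of_smul).mp (hyreg.pow s) m (hs y hy m hm)

end Depth
-- Good filtrations and superficial elements
namespace Ideal.Filtration
variable {R : Type*} [CommRing R] {M : Type*} [AddCommGroup M] [Module R M] {q : Ideal R}

theorem IsGood.quotient {F : q.Filtration M} (hF : F.IsGood) (N : Submodule R M) :
    (F.quotient N).IsGood where
  zero_eq_top := by
    change (F.N 0).map N.mkQ = ⊤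
    rw [hF.zero_eq_top, Submodule.map_top, Submodule.range_mkQ]
  stable := by
    obtain ⟨n₀, h⟩ := hF.stable
    refine ⟨n₀, fun n hn => ?_⟩
    change q • (F.N n).map N.mkQ = (F.N (n + 1)).map N.mkQ
    rw [← Submodule.map_smul'', h n hn]

theorem IsGood.pow_smul_top_le {F : q.Filtration M} (hF : F.IsGood) (n : ℕ) :
    q ^ n • (⊤ : Submodule R M) ≤ F.N n := by
  simpa [hF.zero_eq_top] using F.pow_smul_le n 0

theorem IsGood.exists_le_pow_smul_top {F : q.Filtration M} (hF : F.IsGood) :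
    ∃ n₀, ∀ n, F.N (n + n₀) ≤ q ^ n • (⊤ : Submodule R M) := by
  simpa using hF.stable.exists_forall_le (F' := q.stableFiltration ⊤)
    (by simp [hF.zero_eq_top])

theorem comap_mkQ_quotient (F : q.Filtration M) (N : Submodule R M) (n : ℕ) :
    ((F.quotient N).N n).comap N.mkQ = N ⊔ F.N n := Submodule.comap_map_mkQ _ _

theorem sup_antitone (F : q.Filtration M) (N : Submodule R M) : Antitone fun n => N ⊔ F.N n :=
  fun _ _ h => sup_le_sup_left (F.antitone h) N

theorem smul_mem_sup (F : q.Filtration M) (N : Submodule R M) {a : R} (ha : a ∈ q) {n : ℕ} {m : M}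
    (hm : m ∈ N ⊔ F.N n) : a • m ∈ N ⊔ F.N (n + 1) := by
  obtain ⟨y, hy, z, hz, rfl⟩ := Submodule.mem_sup.mp hm
  rw [smul_add]
  exact Submodule.add_mem_sup (N.smul_mem a hy) (F.smul_le n (Submodule.smul_mem_smul ha hz))

theorem IsSuperficial.comap_inf_sup {F : q.Filtration M} {N : Submodule R M} {b : R}
    (hb : (F.quotient N).IsSuperficial b) :
    ∃ c, ∀ n ≥ c, (N ⊔ F.N (n + 1)).comap (LinearMap.lsmul R M b) ⊓ (N ⊔ F.N c) = N ⊔ F.N n := by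
  obtain ⟨-, c, hc⟩ := hb
  refine ⟨c, fun n hn => ?_⟩
  have := congrArg (Submodule.comap N.mkQ) (hc n hn)
  simp only [← comap_mkQ_quotient]
  rw [← this]
  rfl

section Noetherian

variable [IsNoetherianRing R] [Module.Finite R M]

/-- Removes the intersection with M_c from superficiality. By Artin–Rees in M/N, an element of bM
lying deep in the filtration is b·y with y already in M_c; the definition then applies to y, and x -
y lies in N : b. -/
theorem IsSuperficial.comap_le {F : q.Filtration M} (hF : F.IsGood) {N : Submodule R M} {b : R}
    (hb : (F.quotient N).IsSuperficial b) :
    ∃ n₀, ∀ n ≥ n₀, (N ⊔ F.N (n + 1)).comap (LinearMap.lsmul R M b) ≤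
      N.comap (LinearMap.lsmul R M b) ⊔ (N ⊔ F.N n) := by
  obtain ⟨c, hc⟩ := hb.comap_inf_sup
  obtain ⟨n₁, hn₁⟩ := (hF.quotient N).exists_le_pow_smul_top
  let T : Submodule R (M ⧸ N) := Ideal.span {b} • ⊤
  obtain ⟨k, hk⟩ := q.exists_pow_inf_eq_pow_smul T
  -- The summands pay for the q-adic comparison (n₁) and the Artin–Rees constant (k), leaving the
  -- exponent at least c.
  refine ⟨c + k + n₁, fun n hn x hx => ?_⟩
  have hx' : b • N.mkQ x ∈ q ^ (n + 1 - n₁) • (⊤ : Submodule R (M ⧸ N)) ⊓ T := by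
    refine ⟨hn₁ _ ?_, Submodule.smul_mem_smul (Ideal.mem_span_singleton_self b) trivial⟩
    rw [Nat.sub_add_cancel (by omega), ← map_smul, ← Submodule.mem_comap, comap_mkQ_quotient]
    exact hx
  rw [hk _ (by omega)] at hx'
  have hle : q ^ (n + 1 - n₁ - k) • (q ^ k • ⊤ ⊓ T) ≤
      Ideal.span {b} • q ^ c • (⊤ : Submodule R (M ⧸ N)) := by
    refine (Submodule.smul_mono (Ideal.pow_le_pow_right (by omega : c ≤ _)) inf_le_right).trans ?_
    change _ • (Ideal.span {b} • (⊤ : Submodule R (M ⧸ N))) ≤ _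
    rw [← Submodule.mul_smul, ← Submodule.mul_smul, mul_comm]
  have hx'' := hle hx'
  rw [Submodule.ideal_span_singleton_smul] at hx''
  obtain ⟨y', hy', hxy⟩ := hx''
  have hy'' : y' ∈ (F.quotient N).N c := (hF.quotient N).pow_smul_top_le c hy'
  obtain ⟨y, rfl⟩ := N.mkQ_surjective y'
  rw [← Submodule.mem_comap, comap_mkQ_quotient] at hy''
  have hsub : b • (x - y) ∈ N := by
    rw [← Submodule.Quotient.mk_eq_zero]
    change N.mkQ _ = 0
    rw [map_smul, map_sub, smul_sub, sub_eq_zero]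
    exact hxy.symm
  have hby : b • y ∈ N ⊔ F.N (n + 1) := by
    have : b • y = b • x - b • (x - y) := by rw [smul_sub]; abel
    rw [this]
    exact Submodule.sub_mem _ hx (Submodule.mem_sup_left hsub)
  have hyn : y ∈ N ⊔ F.N n := by
    rw [← hc n (by omega)]
    exact ⟨hby, hy''⟩
  rw [← sub_add_cancel x y]
  exact Submodule.add_mem_sup hsub hyn

/-- Krull's intersection theorem on M/N, the filtration being cofinal with the q-adic one. -/
theorem IsGood.mem_of_forall_mem_sup [IsLocalRing R] {F : q.Filtration M} (hF : F.IsGood)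
    (hq : q ≠ ⊤) {N : Submodule R M} {m : M} (hm : ∀ n, m ∈ N ⊔ F.N n) : m ∈ N := by
  obtain ⟨n₀, h⟩ := (hF.quotient N).exists_le_pow_smul_top
  have : N.mkQ m ∈ ⨅ i : ℕ, q ^ i • (⊤ : Submodule R (M ⧸ N)) := by
    refine Submodule.mem_iInf _ |>.mpr fun i => h i ?_
    rw [← Submodule.mem_comap, comap_mkQ_quotient]
    exact hm _
  rw [Ideal.iInf_pow_smul_eq_bot_of_isLocalRing q hq] at this
  simpa using this

/-- Modulo `N`, the elements killed by a superficial element are killed by a power of `q`. -/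
theorem IsSuperficial.pow_smul_comap_le [IsLocalRing R] {F : q.Filtration M} (hF : F.IsGood)
    (hq : q ≠ ⊤) {N : Submodule R M} {b : R} (hb : (F.quotient N).IsSuperficial b) :
    ∃ c, q ^ c • N.comap (LinearMap.lsmul R M b) ≤ N := by
  obtain ⟨c, hc⟩ := hb.comap_inf_sup
  refine ⟨c, Submodule.smul_le.mpr fun r hr x hx => hF.mem_of_forall_mem_sup hq fun n => ?_⟩
  have h1 : r • x ∈ N.comap (LinearMap.lsmul R M b) := Submodule.smul_mem _ _ hx
  have h2 : r • x ∈ F.N c := hF.pow_smul_top_le c (Submodule.smul_mem_smul hr trivial)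
  have h3 : r • x ∈ N ⊔ F.N (max n c) := by
    rw [← hc _ (le_max_right n c)]
    exact ⟨Submodule.mem_sup_left h1, Submodule.mem_sup_right h2⟩
  exact F.sup_antitone N (le_max_left n c) h3

end Noetherian
end Ideal.Filtration

/-! ### Finite length and dimension zero -/

section LocalLength
variable {R : Type*} [CommRing R] [IsLocalRing R] [IsNoetherianRing R] {M : Type*} [AddCommGroup M]
  [Module R M] [Module.Finite R M] {q : Ideal R}

theorem length_quotient_ne_top (hq : q.radical = maximalIdeal R) {P : Submodule R M} {n : ℕ}
    (h : q ^ n • (⊤ : Submodule R M) ≤ P) : Module.length R (M ⧸ P) ≠ ⊤ := by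
  suffices h' : Module.length R (M ⧸ q ^ n • (⊤ : Submodule R M)) ≠ ⊤ from
    ne_top_of_le_ne_top h' (length_quotient_anti h)
  have hart : IsArtinianRing (R ⧸ q ^ n) := by
    obtain rfl | hn := eq_or_ne n 0
    · have : Subsingleton (R ⧸ q ^ 0) := by
        rw [pow_zero]; exact Ideal.Quotient.subsingleton_iff.mpr Ideal.one_eq_top
      infer_instance
    · refine IsLocalRing.quotient_artinian_of_mem_minimalPrimes_of_isLocalRing _ ?_
      rw [← Ideal.radical_minimalPrimes, Ideal.radical_pow _ hn, hq,
        Ideal.minimalPrimes_eq_subsingleton_self]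
      rfl
  have : IsArtinian (R ⧸ q ^ n) (M ⧸ q ^ n • (⊤ : Submodule R M)) :=
    have : Module.Finite (R ⧸ q ^ n) (M ⧸ q ^ n • (⊤ : Submodule R M)) :=
      Module.Finite.of_restrictScalars_finite R _ _
    inferInstance
  have : IsArtinian R (M ⧸ q ^ n • (⊤ : Submodule R M)) :=
    isArtinian_of_surjective_algebraMap (R := R ⧸ q ^ n) Ideal.Quotient.mk_surjective
  exact Module.length_ne_top

/-- The support is contained in the closed point, so q lies in the radical of the annihilator of
M/N. -/
theorem exists_pow_smul_top_le_of_supportDim_le_zero (hq : q ≠ ⊤) (N : Submodule R M)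
    (h : Module.supportDim R (M ⧸ N) ≤ 0) : ∃ s, q ^ s • (⊤ : Submodule R M) ≤ N := by
  have hsupp : Module.support R (M ⧸ N) ⊆ PrimeSpectrum.zeroLocus (maximalIdeal R) := by
    cases subsingleton_or_nontrivial (M ⧸ N) with
    | inl _ => simp [Module.support_eq_empty]
    | inr _ =>
      refine (support_of_supportDim_eq_zero R (M ⧸ N) (le_antisymm h ?_)).le
      have hne := Module.supportDim_ne_bot_of_nontrivial R (M ⧸ N)
      rw [Module.supportDim] at hne ⊢
      have : Nonempty (Module.support R (M ⧸ N)) := Module.nonempty_support_of_nontrivial.to_subtype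
      exact Order.krullDim_nonneg
  rw [Module.support_eq_zeroLocus, PrimeSpectrum.zeroLocus_subset_zeroLocus_iff] at hsupp
  obtain ⟨s, hs⟩ := Ideal.exists_pow_le_of_le_radical_of_fg ((le_maximalIdeal hq).trans hsupp)
    (IsNoetherian.noetherian q)
  refine ⟨s, Submodule.smul_le.mpr fun r hr m _ => ?_⟩
  rw [← Submodule.Quotient.mk_eq_zero, Submodule.Quotient.mk_smul]
  exact Module.mem_annihilator.mp (hs hr) _

end LocalLength

/-! ### Initial segments of a sequence -/

section PartialSpan
open RingTheory.Sequence
variable {A : Type*} [CommRing A] {M : Type*} [AddCommGroup M] [Module A M]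

/-- The ideal generated by the first `i` terms of a sequence. -/
def partialSpan (x : ℕ → A) (i : ℕ) : Ideal A := Ideal.span (x '' Set.Iio i)

@[simp]
theorem partialSpan_zero (x : ℕ → A) : partialSpan x 0 = ⊥ := by
  simp [partialSpan]

theorem partialSpan_succ (x : ℕ → A) (i : ℕ) :
    partialSpan x (i + 1) = partialSpan x i ⊔ Ideal.span {x i} := by
  rw [partialSpan, partialSpan, ← Ideal.span_union]
  congr 1
  ext y
  simp only [Set.mem_image, Set.mem_Iio, Set.mem_union, Set.mem_singleton_iff]
  constructor
  · rintro ⟨j, hj, rfl⟩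
    rcases Nat.lt_succ_iff_lt_or_eq.mp hj with h | rfl
    · exact Or.inl ⟨j, h, rfl⟩
    · exact Or.inr rfl
  · rintro (⟨j, hj, rfl⟩ | rfl)
    · exact ⟨j, by omega, rfl⟩
    · exact ⟨i, by omega, rfl⟩

theorem partialSpan_succ_smul (x : ℕ → A) (i : ℕ) (P : Submodule A M) :
    partialSpan x (i + 1) • P = partialSpan x i • P ⊔ Ideal.span {x i} • P := by
  rw [partialSpan_succ, Submodule.sup_smul]

theorem partialSpan_le {x : ℕ → A} {i : ℕ} {I : Ideal A} (h : ∀ j < i, x j ∈ I) :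
    partialSpan x i ≤ I :=
  Ideal.span_le.mpr (Set.image_subset_iff.mpr h)

theorem ofList_map_range (x : ℕ → A) (i : ℕ) :
    Ideal.ofList ((List.range i).map x) = partialSpan x i := by
  rw [Ideal.ofList, partialSpan]
  congr 1
  ext y
  simp

theorem isSMulRegular_quotient_iff {N : Submodule A M} {b : A} :
    IsSMulRegular (M ⧸ N) b ↔ N.comap (LinearMap.lsmul A M b) ≤ N := by
  rw [isSMulRegular_iff_right_eq_zero_of_smul]
  constructor
  · intro h m hm
    rw [← Submodule.Quotient.mk_eq_zero]
    refine h _ ?_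
    rw [← Submodule.Quotient.mk_smul, Submodule.Quotient.mk_eq_zero]
    exact hm
  · intro h m hm
    obtain ⟨m, rfl⟩ := Submodule.Quotient.mk_surjective _ m
    rw [← Submodule.Quotient.mk_smul, Submodule.Quotient.mk_eq_zero] at hm
    rw [Submodule.Quotient.mk_eq_zero]
    exact h hm

theorem isWeaklyRegular_map_range_iff (x : ℕ → A) (n : ℕ) :
    IsWeaklyRegular M ((List.range n).map x) ↔ ∀ i < n,
      (partialSpan x i • (⊤ : Submodule A M)).comap (LinearMap.lsmul A M (x i)) ≤
        partialSpan x i • (⊤ : Submodule A M) := by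
  rw [isWeaklyRegular_iff]
  simp only [List.length_map, List.length_range, List.getElem_map, List.getElem_range]
  refine forall_congr' fun i => forall_congr' fun hi => ?_
  rw [← List.map_take, List.take_range, min_eq_left hi.le, ofList_map_range, isSMulRegular_quotient_iff]

/-- If the depth of `M` is at least `n` and each `x i` is regular modulo the previous ones up to
elements killed by a power of `I`, then `x 0, …, x (n - 1)` is weakly regular. -/
theorem comap_partialSpan_smul_top_le [IsNoetherianRing A] [Module.Finite A M] {I : Ideal A}
    (hI : I • (⊤ : Submodule A M) ≠ ⊤) {n : ℕ} (hn : (n : ℕ∞) ≤ moduleDepth I M) {x : ℕ → A}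
    (hxI : ∀ i < n, x i ∈ I)
    (hx : ∀ i < n, (∀ j < i, (partialSpan x j • (⊤ : Submodule A M)).comap
        (LinearMap.lsmul A M (x j)) ≤ partialSpan x j • (⊤ : Submodule A M)) →
      ∃ s, ∀ y ∈ I, ∀ m : M, x i • m ∈ partialSpan x i • (⊤ : Submodule A M) →
        y ^ s • m ∈ partialSpan x i • (⊤ : Submodule A M)) :
    ∀ i < n, (partialSpan x i • (⊤ : Submodule A M)).comap (LinearMap.lsmul A M (x i)) ≤
        partialSpan x i • (⊤ : Submodule A M) := by
  intro i
  induction i using Nat.strong_induction_on with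
  | _ i ih =>
    intro hi
    obtain ⟨s, hs⟩ := hx i hi fun j hj => ih j hj (hj.trans hi)
    rw [← isSMulRegular_quotient_iff, ← ofList_map_range]
    refine isSMulRegular_of_pow_mul_le hI hn (fun y hy => ?_)
      ((isWeaklyRegular_map_range_iff x i).mpr fun j hj => ih j hj (hj.trans hi)) (by simpa) ⟨s, ?_⟩
    · obtain ⟨j, hj, rfl⟩ := List.mem_map.mp hy
      exact hxI j ((List.mem_range.mp hj).trans hi)
    · intro y hy m hm
      obtain ⟨m, rfl⟩ := Submodule.Quotient.mk_surjective _ m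
      rw [← Submodule.Quotient.mk_smul, Submodule.Quotient.mk_eq_zero, ofList_map_range] at hm ⊢
      exact hs y hy m hm

end PartialSpan

/-! ### Superficial sequences over a local ring -/

namespace Ideal.Filtration
section Local
variable {R : Type*} [CommRing R] [IsLocalRing R] [IsNoetherianRing R] {M : Type*} [AddCommGroup M]
  [Module R M] [Module.Finite R M] {q : Ideal R}

/-- A superficial element of a one-dimensional module is a parameter. -/
theorem IsSuperficial.exists_pow_smul_top_le (hq : q.radical = maximalIdeal R) {F : q.Filtration M}
    (hF : F.IsGood) {N : Submodule R M} {b : R} (hb : (F.quotient N).IsSuperficial b)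
    (hdim : Module.supportDim R (M ⧸ N) = 1) :
    ∃ s, q ^ s • (⊤ : Submodule R M) ≤ N ⊔ Ideal.span {b} • (⊤ : Submodule R M) := by
  have hqm : q ≤ maximalIdeal R := hq ▸ Ideal.le_radical
  have hq' : q ≠ ⊤ := fun h => (maximalIdeal.isMaximal R).ne_top (top_le_iff.mp (h ▸ hqm))
  refine exists_pow_smul_top_le_of_supportDim_le_zero hq' _ ?_
  -- A minimal prime p containing b is the annihilator of some y in M/N. Then by = 0 gives q^c y =
  -- 0, so p contains q^c and is maximal, and the dimension would be zero.
  have hmin : ∀ p ∈ (Module.annihilator R (M ⧸ N)).minimalPrimes, b ∉ p := by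
    intro p hp hbp
    have hass := Module.associatedPrimes.minimalPrimes_annihilator_subset_associatedPrimes R _ hp
    have hpp : p.IsPrime := hass.isPrime
    obtain ⟨y, hy⟩ := (isAssociatedPrime_iff.mp hass).2
    obtain ⟨y, rfl⟩ := Submodule.Quotient.mk_surjective _ y
    have hmem : ∀ r, r ∈ p ↔ r • y ∈ N := by
      intro r
      rw [hy, Submodule.mem_colon_singleton, ← Submodule.Quotient.mk_smul, Submodule.mem_bot,
        Submodule.Quotient.mk_eq_zero]
    obtain ⟨c, hc⟩ := hb.pow_smul_comap_le hF hq'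
    have hqp : q ^ c ≤ p := fun r hr =>
      (hmem r).mpr (hc (Submodule.smul_mem_smul hr ((hmem b).mp hbp)))
    have hmp : maximalIdeal R ≤ p := hq ▸ hpp.radical_le_iff.mpr (hpp.le_of_pow_le hqp)
    have hsub : Subsingleton (Module.support R (M ⧸ N)) := by
      refine ⟨fun P Q => ?_⟩
      have key : ∀ P : Module.support R (M ⧸ N), P.1.asIdeal = maximalIdeal R := by
        intro P
        have hP := (Module.support_eq_zeroLocus (R := R) (M := M ⧸ N)).le P.2
        have hle := le_maximalIdeal P.1.isPrime.ne_top
        exact le_antisymm hle (hmp.trans (hp.2 ⟨P.1.isPrime, hP⟩ (hle.trans hmp)))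
      exact Subtype.ext (PrimeSpectrum.ext ((key P).trans (key Q).symm))
    have hle : Module.supportDim R (M ⧸ N) ≤ 0 := Order.krullDim_nonpos_of_subsingleton
    rw [hdim] at hle
    exact absurd hle (by decide)
  have hdim' := Module.supportDim_quotSMulTop_succ_le_of_notMem_minimalPrimes hmin
  rw [hdim] at hdim'
  have e : QuotSMulTop b (M ⧸ N) ≃ₗ[R] M ⧸ (N ⊔ Ideal.span {b} • (⊤ : Submodule R M)) :=
    (Submodule.quotEquivOfEq _ _ (by
      rw [Submodule.map_smul'', Submodule.map_top, Submodule.range_mkQ,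
        Submodule.ideal_span_singleton_smul])).trans
      (Submodule.quotientQuotientEquivQuotientSup N (Ideal.span {b} • (⊤ : Submodule R M)))
  rw [← Module.supportDim_eq_of_equiv e]
  generalize Module.supportDim R (QuotSMulTop b (M ⧸ N)) = D at hdim'
  rw [show (1 : WithBot ℕ∞) = 0 + 1 from rfl] at hdim'
  induction D with
  | bot => exact bot_le
  | coe D =>
    norm_cast at hdim' ⊢
    exact (ENat.add_le_add_iff_right ENat.one_ne_top).mp hdim'

variable {F : q.Filtration M} {x : ℕ → R}

/-- Depth turns superficial into regular: the torsion of x_i modulo the earlier terms is killed by a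
power of q, hence by a power of each element of the maximal ideal. -/
theorem IsGood.comap_partialSpan_smul_top_le (hq : q.radical = maximalIdeal R) (hF : F.IsGood)
    {n : ℕ} (hn : (n : ℕ∞) ≤ moduleDepth (maximalIdeal R) M) [Nontrivial M]
    (hx : ∀ i < n, (F.quotient (partialSpan x i • (⊤ : Submodule R M))).IsSuperficial (x i)) :
    ∀ i < n, (partialSpan x i • (⊤ : Submodule R M)).comap (LinearMap.lsmul R M (x i)) ≤
        partialSpan x i • (⊤ : Submodule R M) := by
  have hqm : q ≤ maximalIdeal R := hq ▸ Ideal.le_radical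
  have hq' : q ≠ ⊤ := fun h => (maximalIdeal.isMaximal R).ne_top (top_le_iff.mp (h ▸ hqm))
  refine _root_.comap_partialSpan_smul_top_le (I := maximalIdeal R) ?_ hn
    (fun i hi => hqm (hx i hi).1) fun i hi _ => ?_
  · exact (Submodule.top_ne_ideal_smul_of_le_jacobson_annihilator
      (maximalIdeal_le_jacobson _)).symm
  · obtain ⟨c, hc⟩ := (hx i hi).pow_smul_comap_le hF hq'
    obtain ⟨k, hk⟩ := Ideal.exists_pow_le_of_le_radical_of_fg hq.ge
      (IsNoetherian.noetherian (maximalIdeal R))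
    refine ⟨k * c, fun y hy m hm => hc (Submodule.smul_mem_smul ?_ hm)⟩
    rw [pow_mul]
    exact Ideal.pow_mem_pow (hk (Ideal.pow_mem_pow hy k)) c

theorem supportDim_quotient_partialSpan {n : ℕ} [Nontrivial M] (hxm : ∀ i < n, x i ∈ maximalIdeal R)
    (hx : ∀ i < n, (partialSpan x i • (⊤ : Submodule R M)).comap (LinearMap.lsmul R M (x i)) ≤
        partialSpan x i • (⊤ : Submodule R M)) :
    Module.supportDim R (M ⧸ partialSpan x n • (⊤ : Submodule R M)) + n = Module.supportDim R M := by
  have h := Module.supportDim_add_length_eq_supportDim_of_isRegular (M := M)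
    ((List.range n).map x) (RingTheory.Sequence.IsRegular.of_isWeaklyRegular_of_mem_maximalIdeal _
      (fun y hy => ?_) ((isWeaklyRegular_map_range_iff x n).mpr hx))
  · rw [ofList_map_range] at h
    simpa only [List.length_map, List.length_range] using h
  · obtain ⟨j, hj, rfl⟩ := List.mem_map.mp hy
    exact hxm j (List.mem_range.mp hj)

end Local
end Ideal.Filtration

/-! ### Sally's descent and the intersection property -/

namespace Ideal.Filtration
variable {R : Type*} [CommRing R] {M : Type*} [AddCommGroup M] [Module R M] {q : Ideal R}

/-- Sally's descent: if some `b ∈ q` has an initial form that is regular modulo the superficial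
element `a`, then the initial form of `a` is regular. -/
theorem IsSuperficial.comap_le_of_comap_le {F : q.Filtration M} (hF : F.N 0 = ⊤)
    {N : Submodule R M} {a b : R} (ha : (F.quotient N).IsSuperficial a) (hb : b ∈ q)
    (h : ∀ n, ((N ⊔ Ideal.span {a} • (⊤ : Submodule R M)) ⊔ F.N (n + 1)).comap
        (LinearMap.lsmul R M b) ≤ (N ⊔ Ideal.span {a} • (⊤ : Submodule R M)) ⊔ F.N n) (n : ℕ) :
    (N ⊔ F.N (n + 1)).comap (LinearMap.lsmul R M a) ≤ N ⊔ F.N n := by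
  obtain ⟨c, hc⟩ := ha.comap_inf_sup
  have hpow : ∀ {r : R}, r ∈ q → ∀ (l n : ℕ) (z : M), z ∈ N ⊔ F.N n → r ^ l • z ∈ N ⊔ F.N (n + l) := by
    intro r hr l
    induction l with
    | zero => intro n z hz; simpa using hz
    | succ l ih =>
      intro n z hz
      rw [pow_succ', mul_smul]
      exact F.smul_mem_sup N hr (ih n z hz)
  have hdesc : ∀ (k m : ℕ) (z : M), c ≤ m → z ∈ N ⊔ F.N c → a ^ k • z ∈ N ⊔ F.N (m + k) →
      z ∈ N ⊔ F.N m := by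
    intro k
    induction k with
    | zero => intro m z _ _ hz; simpa using hz
    | succ k ih =>
      intro m z hm hz haz
      refine ih m z hm hz ?_
      rw [← hc (m + k) (by omega)]
      refine ⟨?_, Submodule.smul_mem _ _ hz⟩
      rw [pow_succ', mul_smul] at haz
      exact haz
  have hbdesc : ∀ (l n : ℕ) (z : M),
      b ^ l • z ∈ (N ⊔ Ideal.span {a} • (⊤ : Submodule R M)) ⊔ F.N (n + l) →
      z ∈ (N ⊔ Ideal.span {a} • (⊤ : Submodule R M)) ⊔ F.N n := by
    intro l
    induction l with
    | zero => intro n z hz; simpa using hz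
    | succ l ih =>
      intro n z hz
      refine ih n z (h (n + l) ?_)
      rw [pow_succ', mul_smul] at hz
      exact hz
  -- All powers of a are treated at once, since the induction step on j replaces k by k + 1.
  suffices key : ∀ (j k : ℕ) (z : M), a ^ k • z ∈ N ⊔ F.N (j + k) → z ∈ N ⊔ F.N j from
    fun z hz => key n 1 z (by simpa using hz)
  intro j
  induction j with
  | zero => intro k z _; simp [hF]
  | succ j ih =>
    intro k z hz
    -- Multiplying by b^c moves z into M_c modulo N, where superficiality permits cancelling a; b^c
    -- is then cancelled modulo aM.
    have h1 : b ^ c • z ∈ N ⊔ F.N (j + 1 + c) := by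
      refine hdesc k _ _ (by omega) ?_ ?_
      · simpa using hpow hb c 0 z (by simp [hF])
      · rw [smul_comm]
        have := hpow hb c _ _ hz
        rwa [add_right_comm] at this
    have h2 : z ∈ (N ⊔ Ideal.span {a} • (⊤ : Submodule R M)) ⊔ F.N (j + 1) :=
      hbdesc c _ _ ((sup_le_sup_right le_sup_left _ : N ⊔ F.N (j + 1 + c) ≤ _) h1)
    rw [sup_right_comm] at h2
    obtain ⟨m, hm, w, hw, rfl⟩ := Submodule.mem_sup.mp h2
    rw [Submodule.ideal_span_singleton_smul] at hw
    obtain ⟨y, -, rfl⟩ := hw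
    change a ^ k • (m + a • y) ∈ _ at hz
    have hy : y ∈ N ⊔ F.N j := by
      refine ih (k + 1) y ?_
      have : a ^ (k + 1) • y = a ^ k • (m + a • y) - a ^ k • m := by
        rw [smul_add, pow_succ, mul_smul]; abel
      rw [this, show j + (k + 1) = j + 1 + k by ring]
      exact Submodule.sub_mem _ hz (hpow ha.1 k _ _ hm)
    exact Submodule.add_mem _ hm (F.smul_mem_sup N ha.1 hy)

/-- The Valabrega–Valla intersection property in a single degree. -/
theorem inf_partialSpan_smul_top_le (F : q.Filtration M) {x : ℕ → R} {i : ℕ}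
    (hxq : ∀ j < i, x j ∈ q) {n : ℕ}
    (h : ∀ j < i, (partialSpan x j • (⊤ : Submodule R M) ⊔ F.N (n + 1)).comap
      (LinearMap.lsmul R M (x j)) ≤ partialSpan x j • (⊤ : Submodule R M) ⊔ F.N n) :
    F.N (n + 1) ⊓ partialSpan x i • (⊤ : Submodule R M) ≤ partialSpan x i • F.N n := by
  induction i with
  | zero => simp
  | succ i ih =>
    rintro z ⟨hz, hz'⟩
    rw [SetLike.mem_coe, partialSpan_succ_smul] at hz'
    obtain ⟨ν, hν, w, hw, rfl⟩ := Submodule.mem_sup.mp hz'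
    rw [Submodule.ideal_span_singleton_smul] at hw
    obtain ⟨y, -, rfl⟩ := hw
    change ν + x i • y ∈ F.N (n + 1) at hz
    change ν + x i • y ∈ partialSpan x (i + 1) • F.N n
    have hy : y ∈ partialSpan x i • (⊤ : Submodule R M) ⊔ F.N n := by
      refine h i (by omega) ?_
      change x i • y ∈ partialSpan x i • (⊤ : Submodule R M) ⊔ F.N (n + 1)
      rw [← neg_add_cancel_left ν (x i • y)]
      exact Submodule.add_mem_sup (Submodule.neg_mem _ hν) hz
    obtain ⟨ν', hν', f, hf, rfl⟩ := Submodule.mem_sup.mp hy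
    rw [smul_add, ← add_assoc] at hz
    rw [partialSpan_succ_smul, smul_add, ← add_assoc]
    refine Submodule.add_mem_sup (ih (fun j hj => hxq j (by omega)) (fun j hj => h j (by omega))
      ⟨?_, Submodule.add_mem _ hν (Submodule.smul_mem _ _ hν')⟩)
      (Submodule.smul_mem_smul (Ideal.mem_span_singleton_self _) hf)
    have hxf : x i • f ∈ F.N (n + 1) := F.smul_le n (Submodule.smul_mem_smul (hxq i (by omega)) hf)
    exact (Submodule.add_mem_iff_left _ hxf).mp hz

end Ideal.Filtration

/-! ### Polynomials with nonnegative coefficients and values at 1 -/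

section Polynomials

theorem exists_polynomial_coeff (f : ℕ → ℤ) (B : ℕ) (hf : ∀ n ≥ B, f n = 0) :
    ∃ p : ℤ[X], ∀ n, p.coeff n = f n := by
  refine ⟨∑ i ∈ Finset.range B, monomial i (f i), fun n => ?_⟩
  simp only [finsetSum_coeff, coeff_monomial, Finset.sum_ite_eq', Finset.mem_range]
  split_ifs with h
  · rfl
  · exact (hf n (by omega)).symm

theorem eval_one_nonneg {p : ℤ[X]} (hp : ∀ n, 0 ≤ p.coeff n) : 0 ≤ p.eval 1 := by
  rw [eval_eq_sum_range]
  exact Finset.sum_nonneg fun i _ => by simpa using hp i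

theorem eval_one_eq_zero_iff {p : ℤ[X]} (hp : ∀ n, 0 ≤ p.coeff n) :
    p.eval 1 = 0 ↔ ∀ n, p.coeff n = 0 := by
  constructor
  · intro h n
    rw [eval_eq_sum_range, Finset.sum_eq_zero_iff_of_nonneg fun i _ => by simpa using hp i] at h
    by_cases hn : n ≤ p.natDegree
    · simpa using h n (by simpa [Nat.lt_succ_iff] using hn)
    · exact coeff_eq_zero_of_natDegree_lt (by omega)
  · intro h
    rw [eval_eq_sum_range]
    exact Finset.sum_eq_zero fun i _ => by simp [h i]

theorem coeff_derivative_nonneg {p : ℤ[X]} (hp : ∀ n ≥ 1, 0 ≤ p.coeff n) (n : ℕ) :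
    0 ≤ (derivative p).coeff n := by
  rw [coeff_derivative]
  exact mul_nonneg (hp _ (by omega)) (by positivity)

theorem derivative_eval_one_eq_zero_iff {p : ℤ[X]} (hp : ∀ n ≥ 1, 0 ≤ p.coeff n) :
    (derivative p).eval 1 = 0 ↔ ∀ n ≥ 1, p.coeff n = 0 := by
  rw [eval_one_eq_zero_iff (coeff_derivative_nonneg hp)]
  constructor
  · intro h n hn
    have := h (n - 1)
    rw [coeff_derivative, Nat.sub_add_cancel hn] at this
    exact (mul_eq_zero.mp this).resolve_right (by positivity)
  · intro h n
    rw [coeff_derivative, h _ (by omega), zero_mul]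

theorem derivative_eval_one_eq_sum {p : ℤ[X]} {B : ℕ} (hB : ∀ n ≥ B, p.coeff n = 0) :
    (derivative p).eval 1 = ∑ n ∈ Finset.range B, (n : ℤ) * p.coeff n := by
  rw [derivative_eval, Polynomial.sum_over_range' p (by simp) (max B (p.natDegree + 1))
    (lt_of_lt_of_le (Nat.lt_succ_self _) (le_max_right _ _))]
  · symm
    refine (Finset.sum_subset (Finset.range_mono (le_max_left _ _)) ?_).trans
      (Finset.sum_congr rfl fun n _ => by simp [mul_comm])
    intro n _ hn
    rw [hB n (by simpa using hn), mul_zero]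

/-- Read off the coefficient of Y² after substituting X = 1 + Y. -/
theorem hasseDeriv_two_eval_one (e : ℤ) (G T : ℤ[X]) :
    (hasseDeriv 2 (C e - (1 - X) * G - (1 - X) ^ 2 * T)).eval 1 =
      (derivative G).eval 1 - T.eval 1 := by
  rw [← taylor_coeff]
  have h1 : taylor (1 : ℤ) (1 - X) = -X := by simp
  have h2 : taylor (1 : ℤ) (C e - (1 - X) * G - (1 - X) ^ 2 * T) =
      C e + taylor 1 G * X - taylor 1 T * X ^ 2 := by
    rw [map_sub, map_sub, taylor_mul, taylor_mul, taylor_pow, h1, taylor_C]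
    ring
  rw [h2, coeff_sub, coeff_add, coeff_mul_X, coeff_mul_X_pow' , coeff_C]
  simp [taylor_coeff_one, taylor_coeff_zero]

/-- Unwinding the recursion leaves every U_i with i < k multiplied by a positive power of 1 - X, so
only the last defect contributes to T(1). -/
theorem exists_mul_one_sub_X_pow_eq (H : ℕ → PowerSeries ℤ) (U : ℕ → ℤ[X]) (k : ℕ)
    (h : ∀ i ≤ k, H (i + 1) = (1 - PowerSeries.X) * (H i + (U i : PowerSeries ℤ))) :
    ∃ T : ℤ[X], T.eval 1 = (U k).eval 1 ∧
      H 0 * (1 - PowerSeries.X) ^ (k + 1) =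
        H (k + 1) - (1 - PowerSeries.X) * (T : PowerSeries ℤ) := by
  induction k with
  | zero => exact ⟨U 0, rfl, by rw [h 0 le_rfl]; ring⟩
  | succ k ih =>
    obtain ⟨T, -, hT⟩ := ih fun i hi => h i (by omega)
    refine ⟨(1 - X) * T + U (k + 1), by simp, ?_⟩
    rw [pow_succ, ← mul_assoc, hT, h (k + 1) le_rfl]
    simp only [Polynomial.coe_add, Polynomial.coe_mul, Polynomial.coe_sub, Polynomial.coe_one,
      Polynomial.coe_X]
    ring

end Polynomials

/-! ### Integer colengths and Hilbert series of quotients -/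

section Colength
variable {R : Type*} [CommRing R] {M : Type*} [AddCommGroup M] [Module R M]

/-- The length of `M ⧸ P` as an integer. -/
def colength (P : Submodule R M) : ℤ := (Module.length R (M ⧸ P)).toNat

theorem colength_eq_add {P' P : Submodule R M} (h : P' ≤ P)
    (hfin : Module.length R (M ⧸ P') ≠ ⊤) :
    colength P' = (quotLength P P').toNat + colength P := by
  have h1 := ne_top_of_le_ne_top hfin (quotLength_le_length_quotient h)
  have h2 := ne_top_of_le_ne_top hfin (length_quotient_anti h)
  rw [colength, colength, length_quotient_eq_add h, ENat.toNat_add h1 h2]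
  push_cast
  rfl

theorem colength_sup_add {A B : Submodule R M} {b : R}
    (h : A ≤ B.comap (LinearMap.lsmul R M b)) (hA : Module.length R (M ⧸ A) ≠ ⊤)
    (hB : Module.length R (M ⧸ B) ≠ ⊤) :
    colength (B ⊔ Ideal.span {b} • (⊤ : Submodule R M)) + colength A =
      colength B + (quotLength (B.comap (LinearMap.lsmul R M b)) A).toNat := by
  have h1 := ne_top_of_le_ne_top hB (length_quotient_anti (le_sup_left :
    B ≤ B ⊔ Ideal.span {b} • (⊤ : Submodule R M)))
  have h2 := ne_top_of_le_ne_top hA (quotLength_le_length_quotient h)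
  have := congrArg ENat.toNat (length_quotient_sup_add h)
  rw [ENat.toNat_add h1 hA, ENat.toNat_add hB h2] at this
  unfold colength
  exact_mod_cast this

theorem quotLength_eq_add {P'' P' : Submodule R M} (h : P'' ≤ P')
    (P : Submodule R M) : quotLength P P'' = quotLength (P'.submoduleOf P) (P''.submoduleOf P) + quotLength P P' :=
  length_quotient_eq_add (Submodule.comap_mono h : P''.submoduleOf P ≤ P'.submoduleOf P)

theorem eq_of_quotLength_eq {P'' P' P : Submodule R M} (h : P'' ≤ P') (h' : P' ≤ P)
    (hfin : quotLength P P'' ≠ ⊤) (heq : quotLength P P' = quotLength P P'') : P' = P'' := by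
  rw [quotLength_eq_add h P, eq_comm] at heq
  have h1 : quotLength P P' ≠ ⊤ := ne_top_of_le_ne_top hfin (quotLength_anti h)
  have h0 : quotLength (P'.submoduleOf P) (P''.submoduleOf P) = 0 := by
    exact WithTop.add_right_cancel h1 (heq.trans (zero_add _).symm)
  replace h0 := (quotLength_eq_zero_iff (Submodule.comap_mono h)).mp h0
  refine le_antisymm (fun y hy => ?_) h
  have : (⟨y, h' hy⟩ : P) ∈ P'.comap P.subtype := hy
  rw [h0] at this
  exact this

end Colength

section Support
variable {R : Type*} [CommRing R] [IsLocalRing R] {M : Type*} [AddCommGroup M]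
  [Module R M] [Module.Finite R M] {q : Ideal R}

theorem supportDim_quotient_le_zero (hq : q.radical = maximalIdeal R) {N : Submodule R M} {s : ℕ}
    (h : q ^ s • (⊤ : Submodule R M) ≤ N) : Module.supportDim R (M ⧸ N) ≤ 0 := by
  have key : ∀ P : Module.support R (M ⧸ N), P.1.asIdeal = maximalIdeal R := by
    intro P
    have hP : Module.annihilator R (M ⧸ N) ≤ P.1.asIdeal :=
      (Module.support_eq_zeroLocus (R := R) (M := M ⧸ N)).le P.2
    have hqs : q ^ s ≤ Module.annihilator R (M ⧸ N) := by
      intro r hr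
      refine Module.mem_annihilator.mpr fun m => ?_
      obtain ⟨m, rfl⟩ := Submodule.Quotient.mk_surjective _ m
      rw [← Submodule.Quotient.mk_smul, Submodule.Quotient.mk_eq_zero]
      exact h (Submodule.smul_mem_smul hr trivial)
    refine le_antisymm (le_maximalIdeal P.1.isPrime.ne_top) ?_
    rw [← hq]
    exact P.1.isPrime.radical_le_iff.mpr (P.1.isPrime.le_of_pow_le (hqs.trans hP))
  have : Subsingleton (Module.support R (M ⧸ N)) :=
    ⟨fun P Q => Subtype.ext (PrimeSpectrum.ext ((key P).trans (key Q).symm))⟩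
  exact Order.krullDim_nonpos_of_subsingleton

end Support

section Local
variable {R : Type*} [CommRing R] [IsLocalRing R] [IsNoetherianRing R] {M : Type*} [AddCommGroup M]
  [Module R M] [Module.Finite R M] {q : Ideal R}

namespace Ideal.Filtration
variable {F : q.Filtration M}

theorem IsGood.length_quotient_ne_top (hq : q.radical = maximalIdeal R) (hF : F.IsGood)
    {P : Submodule R M} {n : ℕ} (h : F.N n ≤ P) : Module.length R (M ⧸ P) ≠ ⊤ :=
  _root_.length_quotient_ne_top hq ((hF.pow_smul_top_le n).trans h)

/-- The Hilbert series of the filtration induced on `M ⧸ N`. -/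
def supSeries (F : q.Filtration M) (N : Submodule R M) : PowerSeries ℤ :=
  PowerSeries.mk fun n => colength (N ⊔ F.N (n + 1)) - colength (N ⊔ F.N n)

theorem IsGood.hilbertSeries_eq (hq : q.radical = maximalIdeal R) (hF : F.IsGood) :
    F.hilbertSeries = F.supSeries ⊥ := by
  ext n
  rw [hilbertSeries, supSeries, PowerSeries.coeff_mk, PowerSeries.coeff_mk, bot_sup_eq, bot_sup_eq,
    colength_eq_add (F.mono n) (hF.length_quotient_ne_top hq le_rfl)]
  simp [hilbertFunction]

theorem IsGood.supSeries_sup (hq : q.radical = maximalIdeal R) (hF : F.IsGood) {N : Submodule R M}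
    {a : R} (ha : a ∈ q) (U : ℤ[X]) (hU : ∀ n, U.coeff n =
      (quotLength ((N ⊔ F.N (n + 1)).comap (LinearMap.lsmul R M a)) (N ⊔ F.N n)).toNat) :
    F.supSeries (N ⊔ Ideal.span {a} • (⊤ : Submodule R M)) =
      (1 - PowerSeries.X) * (F.supSeries N + (U : PowerSeries ℤ)) := by
  have hstep : ∀ n, colength ((N ⊔ Ideal.span {a} • (⊤ : Submodule R M)) ⊔ F.N (n + 1)) =
      colength (N ⊔ F.N (n + 1)) - colength (N ⊔ F.N n) + U.coeff n := by
    intro n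
    have := colength_sup_add (A := N ⊔ F.N n) (B := N ⊔ F.N (n + 1)) (b := a)
      (fun m hm => F.smul_mem_sup N ha hm) (hF.length_quotient_ne_top hq le_sup_right)
      (hF.length_quotient_ne_top hq le_sup_right)
    rw [hU, sup_right_comm]
    linarith
  ext n
  rw [sub_mul, one_mul, map_sub]
  -- In degree zero the shifted term is absent, which agrees with M/(N + M_0) = 0.
  cases n with
  | zero =>
    rw [PowerSeries.coeff_zero_X_mul, supSeries, supSeries, PowerSeries.coeff_mk, hstep, map_add,
      PowerSeries.coeff_mk, Polynomial.coeff_coe, hF.zero_eq_top]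
    have : colength (⊤ : Submodule R M) = 0 := by simp [colength]
    simp [this]
  | succ n =>
    rw [PowerSeries.coeff_succ_X_mul, supSeries, supSeries, PowerSeries.coeff_mk, hstep, hstep,
      map_add, map_add, PowerSeries.coeff_mk, PowerSeries.coeff_mk, Polynomial.coeff_coe,
      Polynomial.coeff_coe]

end Ideal.Filtration
end Local
-- The one-dimensional case
namespace Ideal.Filtration

section Module
variable {R : Type*} [CommRing R] {M : Type*} [AddCommGroup M] [Module R M]

theorem comap_sup_span_smul (N P : Submodule R M) (b : R) :
    (N ⊔ Ideal.span {b} • P).comap (LinearMap.lsmul R M b) =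
      N.comap (LinearMap.lsmul R M b) ⊔ P := by
  ext y
  constructor
  · intro hy
    obtain ⟨ν, hν, w, hw, h⟩ := Submodule.mem_sup.mp (Submodule.mem_comap.mp hy)
    rw [Submodule.ideal_span_singleton_smul] at hw
    obtain ⟨f, hf, rfl⟩ := hw
    rw [← sub_add_cancel y f]
    refine Submodule.add_mem_sup ?_ hf
    change b • (y - f) ∈ N
    have h' : ν + b • f = b • y := h
    rwa [smul_sub, ← h', add_sub_cancel_right]
  · intro hy
    obtain ⟨κ, hκ, f, hf, rfl⟩ := Submodule.mem_sup.mp hy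
    change b • (κ + f) ∈ N ⊔ Ideal.span {b} • P
    rw [smul_add]
    exact Submodule.add_mem_sup hκ
      (Submodule.smul_mem_smul (Ideal.mem_span_singleton_self b) hf)

end Module

section Noetherian
variable {R : Type*} [CommRing R] {M : Type*} [AddCommGroup M] [Module R M] {q : Ideal R}
  {F : q.Filtration M} [IsNoetherianRing R] [Module.Finite R M]

/-- Since b is a parameter modulo N, deep elements have the form ν + by; `IsSuperficial.comap_le`
then puts y in M_n up to N : b, which b sends into N. -/
theorem IsSuperficial.sup_le_sup_span_smul (hF : F.IsGood) {N : Submodule R M} {b : R}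
    (hb : (F.quotient N).IsSuperficial b)
    {s : ℕ} (hs : q ^ s • (⊤ : Submodule R M) ≤ N ⊔ Ideal.span {b} • (⊤ : Submodule R M)) :
    ∃ n₀, ∀ n ≥ n₀, N ⊔ F.N (n + 1) ≤ N ⊔ Ideal.span {b} • F.N n := by
  obtain ⟨n₀, hn₀⟩ := hb.comap_le hF
  obtain ⟨n₁, hn₁⟩ := hF.exists_le_pow_smul_top
  refine ⟨max n₀ (s + n₁), fun n hn z hz => ?_⟩
  have hz' : z ∈ N ⊔ Ideal.span {b} • (⊤ : Submodule R M) := by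
    refine (sup_le le_sup_left ((F.antitone ?_).trans ((hn₁ s).trans hs)) :
      N ⊔ F.N (n + 1) ≤ _) hz
    exact (le_max_right n₀ (s + n₁)).trans (by omega)
  obtain ⟨ν, hν, w, hw, rfl⟩ := Submodule.mem_sup.mp hz'
  rw [Submodule.ideal_span_singleton_smul] at hw
  obtain ⟨y, -, rfl⟩ := hw
  change ν + b • y ∈ N ⊔ F.N (n + 1) at hz
  change ν + b • y ∈ N ⊔ Ideal.span {b} • F.N n
  have hy : y ∈ N.comap (LinearMap.lsmul R M b) ⊔ (N ⊔ F.N n) := by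
    refine hn₀ n ((le_max_left _ _).trans hn) ?_
    change b • y ∈ N ⊔ F.N (n + 1)
    exact (Submodule.add_mem_iff_right _ (Submodule.mem_sup_left hν)).mp hz
  obtain ⟨κ, hκ, w, hw, rfl⟩ := Submodule.mem_sup.mp hy
  obtain ⟨μ, hμ, f, hf, rfl⟩ := Submodule.mem_sup.mp hw
  rw [smul_add, smul_add, ← add_assoc, ← add_assoc]
  exact Submodule.add_mem_sup (N.add_mem (N.add_mem hν hκ) (N.smul_mem b hμ))
    (Submodule.smul_mem_smul (Ideal.mem_span_singleton_self b) hf)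

theorem exists_polynomial_coeff_eq_quotLength (hF : F.IsGood) {N : Submodule R M} {a : R}
    (ha : (F.quotient N).IsSuperficial a) (hreg : N.comap (LinearMap.lsmul R M a) ≤ N) :
    ∃ U : ℤ[X], ∀ n, U.coeff n =
      (quotLength ((N ⊔ F.N (n + 1)).comap (LinearMap.lsmul R M a)) (N ⊔ F.N n)).toNat := by
  obtain ⟨n₀, hn₀⟩ := ha.comap_le hF
  refine exists_polynomial_coeff _ n₀ fun n hn => ?_
  have hle : N ⊔ F.N n ≤ (N ⊔ F.N (n + 1)).comap (LinearMap.lsmul R M a) :=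
    fun m hm => F.smul_mem_sup N ha.1 hm
  rw [(quotLength_eq_zero_iff hle).mpr (le_antisymm ((hn₀ n hn).trans
    (sup_le (hreg.trans le_sup_left) le_rfl)) hle)]
  rfl

end Noetherian

section Local
variable {R : Type*} [CommRing R] [IsLocalRing R] [IsNoetherianRing R] {M : Type*} [AddCommGroup M]
  [Module R M] [Module.Finite R M] {q : Ideal R} {F : q.Filtration M}

/-- The Hilbert series of a filtration on a one-dimensional module `M ⧸ N`. -/
theorem IsSuperficial.exists_supSeries_mul_eq (hq : q.radical = maximalIdeal R) (hF : F.IsGood)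
    {N : Submodule R M} {b : R} (hb : (F.quotient N).IsSuperficial b)
    (hs : ∃ s, q ^ s • (⊤ : Submodule R M) ≤ N ⊔ Ideal.span {b} • (⊤ : Submodule R M))
    (hN : ∀ s, ¬ q ^ s • (⊤ : Submodule R M) ≤ N) :
    ∃ (e : ℤ) (V W : ℤ[X]), e ≠ 0 ∧
      (∀ n, V.coeff n = (quotLength (N ⊔ F.N (n + 1)) (N ⊔ Ideal.span {b} • F.N n)).toNat) ∧
      (∀ n, 0 ≤ W.coeff n) ∧
      ((∀ n ≥ 1, W.coeff n = 0) ↔ N.comap (LinearMap.lsmul R M b) ⊓ (N ⊔ F.N 1) = N) ∧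
      F.supSeries N * (1 - PowerSeries.X) =
        ((C e - (1 - X) * (V - W) : ℤ[X]) : PowerSeries ℤ) := by
  have hqm : q ≤ maximalIdeal R := hq ▸ Ideal.le_radical
  have hq' : q ≠ ⊤ := fun h => (maximalIdeal.isMaximal R).ne_top (top_le_iff.mp (h ▸ hqm))
  obtain ⟨s, hs⟩ := hs
  set K := N.comap (LinearMap.lsmul R M b) with hK
  obtain ⟨n₀, hn₀⟩ := hb.sup_le_sup_span_smul hF hs
  obtain ⟨c, hc⟩ := hb.comap_inf_sup
  have hNK : N ≤ K := fun ν hν => N.smul_mem b hν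
  have hle : ∀ n, N ⊔ Ideal.span {b} • F.N n ≤ N ⊔ F.N (n + 1) := fun n =>
    sup_le_sup_left ((Submodule.smul_mono_left
      ((Ideal.span_singleton_le_iff_mem _).mpr hb.1)).trans (F.smul_le n)) N
  -- For y in this intersection, by lies in N, so superficiality puts y in N + M_m for every m ≥ c,
  -- and Krull's theorem applies.
  have hKc : ∀ n ≥ c, K ⊓ (N ⊔ F.N n) = N := by
    intro n hn
    refine le_antisymm (fun y hy => hF.mem_of_forall_mem_sup hq' fun m => ?_) (le_inf hNK le_sup_left)
    refine F.sup_antitone N (le_max_left m c) ?_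
    change y ∈ N ⊔ F.N (max m c)
    rw [← hc _ (le_max_right m c)]
    exact ⟨Submodule.mem_sup_left hy.1, F.sup_antitone N hn hy.2⟩
  have hB : ∀ n, Module.length R (M ⧸ (N ⊔ Ideal.span {b} • F.N n)) ≠ ⊤ := by
    intro n
    refine hF.length_quotient_ne_top hq (n := max n n₀ + 1) (le_sup_right.trans
      ((hn₀ _ (le_max_right n n₀)).trans ?_))
    exact sup_le_sup_left (Submodule.smul_mono le_rfl (F.antitone (le_max_left n n₀))) N
  have hP : ∀ n, Module.length R (M ⧸ (N ⊔ F.N n)) ≠ ⊤ := fun n =>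
    hF.length_quotient_ne_top hq le_sup_right
  have hKsup : ∀ n, K ⊔ F.N n = K ⊔ (N ⊔ F.N n) := fun n => by
    rw [← sup_assoc, sup_eq_left.mpr hNK]
  have hKN : quotLength K N ≠ ⊤ := by
    rw [← hKc c le_rfl, quotLength_inf]
    exact ne_top_of_le_ne_top (hP c) (quotLength_le_length_quotient le_sup_right)
  have hKP : ∀ n, quotLength K (K ⊓ (N ⊔ F.N n)) ≠ ⊤ := fun n =>
    ne_top_of_le_ne_top hKN (quotLength_anti (le_inf hNK le_sup_left))
  obtain ⟨V, hV⟩ := exists_polynomial_coeff (fun n =>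
      ((quotLength (N ⊔ F.N (n + 1)) (N ⊔ Ideal.span {b} • F.N n)).toNat : ℤ)) n₀ fun n hn => by
    rw [(quotLength_eq_zero_iff (hle n)).mpr (le_antisymm (hn₀ n hn) (hle n))]
    rfl
  -- W_n is the length of K ∩ (N + M_n) modulo N, written as a difference.
  obtain ⟨W, hW⟩ := exists_polynomial_coeff (fun n =>
      ((quotLength K N).toNat - (quotLength K (K ⊓ (N ⊔ F.N n))).toNat : ℤ)) c fun n hn => by
    rw [hKc n hn, sub_self]
  -- `colength_sup_add` with B = N + bM_n: here B : b = K + M_n, whose length modulo N + M_n is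
  -- λ(K/N) - W_n, and λ(M/B) exceeds λ(M/(N + M_{n+1})) by V_n.
  have hstep : ∀ n, colength (N ⊔ F.N (n + 1)) - colength (N ⊔ F.N n) =
      colength (N ⊔ Ideal.span {b} • (⊤ : Submodule R M)) - (quotLength K N).toNat
        - (V.coeff n - W.coeff n) := by
    intro n
    have h1 := colength_sup_add (A := N ⊔ F.N n) (B := N ⊔ Ideal.span {b} • F.N n) (b := b)
      (by rw [comap_sup_span_smul]; exact sup_le (hNK.trans le_sup_left) le_sup_right) (hP n) (hB n)
    rw [comap_sup_span_smul, ← hK, hKsup, ← quotLength_inf, sup_assoc, ← Submodule.smul_sup,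
      sup_top_eq] at h1
    have h2 := colength_eq_add (hle n) (hB n)
    rw [hV, hW]
    linarith
  refine ⟨colength (N ⊔ Ideal.span {b} • (⊤ : Submodule R M)) - (quotLength K N).toNat, V, W,
    ?_, hV, ?_, ⟨?_, ?_⟩, ?_⟩
  -- If e = 0 the colengths are eventually constant, so N + M_n stabilizes; by Krull's theorem it
  -- equals N, against `hN`.
  · intro he
    have hconst : ∀ n ≥ max n₀ c, N ⊔ F.N n = N ⊔ F.N (n + 1) := by
      intro n hn
      have hle' := F.sup_antitone N (Nat.le_succ n)
      have h1 := colength_eq_add hle' (hP (n + 1))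
      have h2 := hstep n
      have h3 : V.coeff n = 0 := by
        have hn' : n ≥ n₀ := le_trans (le_max_left _ _) hn
        rw [hV, (quotLength_eq_zero_iff (hle n)).mpr (le_antisymm (hn₀ n hn') (hle n))]
        rfl
      have h4 : W.coeff n = 0 := by
        rw [hW, hKc n (le_trans (le_max_right _ _) hn), sub_self]
      rw [he, h3, h4] at h2
      have h5 : ((quotLength (N ⊔ F.N n) (N ⊔ F.N (n + 1))).toNat : ℤ) = 0 := by
        simp only [Nat.succ_eq_add_one] at h1
        linarith
      have h6 := ENat.toNat_eq_zero.mp (by exact_mod_cast h5) |>.resolve_right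
        (ne_top_of_le_ne_top (hP (n + 1)) (quotLength_le_length_quotient hle'))
      exact (quotLength_eq_zero_iff hle').mp h6
    have hconst' : ∀ m, N ⊔ F.N (max n₀ c) = N ⊔ F.N (max n₀ c + m) := by
      intro m
      induction m with
      | zero => rfl
      | succ m ih => rw [ih, hconst _ (by omega), add_assoc]
    refine hN (max n₀ c) fun y hy => hF.mem_of_forall_mem_sup hq' fun m => ?_
    have : y ∈ N ⊔ F.N (max n₀ c + m) := by
      rw [← hconst' m]
      exact Submodule.mem_sup_right (hF.pow_smul_top_le _ hy)
    exact F.sup_antitone N (Nat.le_add_left m _) this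
  · intro n
    rw [hW, sub_nonneg]
    exact_mod_cast ENat.toNat_le_toNat (quotLength_anti (le_inf hNK le_sup_left)) hKN
  · intro h
    have h1 := h 1 le_rfl
    rw [hW, sub_eq_zero] at h1
    refine eq_of_quotLength_eq (le_inf hNK le_sup_left) inf_le_left hKN ?_
    rw [← ENat.natCast_toNat hKN, ← ENat.natCast_toNat (hKP 1)]
    exact_mod_cast h1.symm
  · intro h n hn
    have : K ⊓ (N ⊔ F.N n) = N := le_antisymm
      ((inf_le_inf_left K (F.sup_antitone N hn)).trans h.le) (le_inf hNK le_sup_left)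
    rw [hW, this, sub_self]
  · have hser : F.supSeries N = PowerSeries.C
        (colength (N ⊔ Ideal.span {b} • (⊤ : Submodule R M)) - (quotLength K N).toNat : ℤ) *
          PowerSeries.mk 1 - ((V - W : ℤ[X]) : PowerSeries ℤ) := by
      ext n
      rw [supSeries, PowerSeries.coeff_mk, hstep, map_sub, PowerSeries.coeff_C_mul,
        PowerSeries.coeff_mk, Polynomial.coeff_coe, coeff_sub, Pi.one_apply, mul_one]
    rw [hser, sub_mul, mul_assoc, PowerSeries.mk_one_mul_one_sub_eq_one]
    simp only [Polynomial.coe_mul, Polynomial.coe_sub, Polynomial.coe_one,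
      Polynomial.coe_X, Polynomial.coe_C]
    ring

end Local
end Ideal.Filtration
-- The h-polynomial and its second coefficient
namespace Ideal.Filtration

section Module
variable {R : Type*} [CommRing R] {M : Type*} [AddCommGroup M] [Module R M] {q : Ideal R}
  {F : q.Filtration M} {x : ℕ → R} {k : ℕ}

theorem IsHPolynomial.unique {d : ℕ} {h h' : ℤ[X]} (H : F.IsHPolynomial d h)
    (H' : F.IsHPolynomial d h') : h = h' :=
  Polynomial.coe_injective ℤ (H.1.trans H'.1.symm)

theorem IsHPolynomial.hilbertCoeff_eq {d : ℕ} {h : ℤ[X]} (H : F.IsHPolynomial d h) (i : ℕ) :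
    F.hilbertCoeff d i = (hasseDeriv i h).eval 1 := by
  have hh : ∃ h, F.IsHPolynomial d h := ⟨h, H⟩
  have : F.hPolynomial d = h := by
    rw [hPolynomial, dif_pos hh]
    exact hh.choose_spec.unique H
  rw [hilbertCoeff, this]

theorem quotLength_partialSpan_eq (hxq : ∀ i < k + 1, x i ∈ q) (n : ℕ) :
    quotLength (partialSpan x k • (⊤ : Submodule R M) ⊔ F.N (n + 1))
        (partialSpan x k • (⊤ : Submodule R M) ⊔ Ideal.span {x k} • F.N n) =
      quotLength (F.N (n + 1)) (F.N (n + 1) ⊓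
        (partialSpan x k • (⊤ : Submodule R M) ⊔ Ideal.span {x k} • F.N n)) := by
  have hle : Ideal.span {x k} • F.N n ≤ F.N (n + 1) := (Submodule.smul_mono_left
    ((Ideal.span_singleton_le_iff_mem _).mpr (hxq k (by omega)))).trans (F.smul_le n)
  rw [quotLength_inf, sup_left_comm, sup_eq_left.mpr hle]

theorem partialSpan_smul_le_inf (hxq : ∀ i < k + 1, x i ∈ q) (n : ℕ) :
    partialSpan x (k + 1) • F.N n ≤ F.N (n + 1) ⊓
      (partialSpan x k • (⊤ : Submodule R M) ⊔ Ideal.span {x k} • F.N n) := by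
  refine le_inf ((Submodule.smul_mono_left (partialSpan_le hxq)).trans (F.smul_le n)) ?_
  rw [partialSpan_succ_smul]
  exact sup_le_sup_right (Submodule.smul_mono le_rfl le_top) _

theorem inf_le_partialSpan_smul (hxq : ∀ i < k + 1, x i ∈ q) {n : ℕ}
    (h : ∀ j < k, (partialSpan x j • (⊤ : Submodule R M) ⊔ F.N (n + 1)).comap
      (LinearMap.lsmul R M (x j)) ≤ partialSpan x j • (⊤ : Submodule R M) ⊔ F.N n) :
    F.N (n + 1) ⊓ (partialSpan x k • (⊤ : Submodule R M) ⊔ Ideal.span {x k} • F.N n) ≤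
      partialSpan x (k + 1) • F.N n := by
  rintro z ⟨hz, hz'⟩
  obtain ⟨ν, hν, w, hw, rfl⟩ := Submodule.mem_sup.mp hz'
  rw [partialSpan_succ_smul]
  refine Submodule.add_mem_sup (F.inf_partialSpan_smul_top_le (fun j hj => hxq j (by omega)) h
    ⟨?_, hν⟩) hw
  refine (Submodule.add_mem_iff_left _ ?_).mp hz
  exact F.smul_le n (Submodule.smul_mono_left
    ((Ideal.span_singleton_le_iff_mem _).mpr (hxq k (by omega))) hw)

end Module

section Noetherian
variable {R : Type*} [CommRing R] [IsNoetherianRing R] {M : Type*} [AddCommGroup M] [Module R M]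
  [Module.Finite R M] {q : Ideal R} {F : q.Filtration M} {x : ℕ → R} {k : ℕ}

/-- J is a reduction of the filtration: for large n both the parameter bound modulo N and the colon
conditions hold, and the intersection property replaces N by its part inside (x_0, …, x_{k-1})M_n.
-/
theorem IsGood.exists_le_partialSpan_smul (hF : F.IsGood)
    (hx : ∀ i < k + 1, (F.quotient (partialSpan x i • (⊤ : Submodule R M))).IsSuperficial (x i))
    (hreg : ∀ i < k, (partialSpan x i • (⊤ : Submodule R M)).comap (LinearMap.lsmul R M (x i)) ≤
        partialSpan x i • (⊤ : Submodule R M))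
    (hs : ∃ s, q ^ s • (⊤ : Submodule R M) ≤ partialSpan x (k + 1) • (⊤ : Submodule R M)) :
    ∃ n₀, ∀ n ≥ n₀, F.N (n + 1) ≤ partialSpan x (k + 1) • F.N n := by
  obtain ⟨s, hs⟩ := hs
  rw [partialSpan_succ_smul] at hs
  obtain ⟨n₁, hn₁⟩ := (hx k (by omega)).sup_le_sup_span_smul hF hs
  have hcol : ∀ᶠ n in Filter.atTop, ∀ j ∈ Finset.range k,
      (partialSpan x j • (⊤ : Submodule R M) ⊔ F.N (n + 1)).comap (LinearMap.lsmul R M (x j)) ≤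
        partialSpan x j • (⊤ : Submodule R M) ⊔ F.N n := by
    rw [Filter.eventually_all_finset]
    intro j hj
    have hj := Finset.mem_range.mp hj
    obtain ⟨n₀, hn₀⟩ := (hx j (by omega)).comap_le hF
    exact Filter.eventually_atTop.mpr ⟨n₀, fun n hn =>
      (hn₀ n hn).trans (sup_le ((hreg j hj).trans le_sup_left) le_rfl)⟩
  obtain ⟨n₂, hn₂⟩ := Filter.eventually_atTop.mp hcol
  refine ⟨max n₁ n₂, fun n hn z hz => ?_⟩
  obtain ⟨ν, hν, w, hw, rfl⟩ := Submodule.mem_sup.mp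
    (hn₁ n ((le_max_left _ _).trans hn) (Submodule.mem_sup_right hz))
  rw [partialSpan_succ_smul]
  refine Submodule.add_mem_sup (F.inf_partialSpan_smul_top_le (fun j hj => (hx j (by omega)).1)
    (fun j hj => hn₂ n ((le_max_right _ _).trans hn) j (Finset.mem_range.mpr hj)) ⟨?_, hν⟩) hw
  refine (Submodule.add_mem_iff_left _ ?_).mp hz
  exact F.smul_le n (Submodule.smul_mono_left
    ((Ideal.span_singleton_le_iff_mem _).mpr (hx k (by omega)).1) hw)

end Noetherian

section Local
variable {R : Type*} [CommRing R] [IsLocalRing R] [IsNoetherianRing R] {M : Type*} [AddCommGroup M]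
  [Module R M] [Module.Finite R M] {q : Ideal R} {F : q.Filtration M} {x : ℕ → R} {k : ℕ}

theorem IsGood.length_quotient_smul_ne_top (hq : q.radical = maximalIdeal R) (hF : F.IsGood)
    {J : Ideal R} {n₀ : ℕ} (hJ : ∀ n ≥ n₀, F.N (n + 1) ≤ J • F.N n) (n : ℕ) :
    Module.length R (M ⧸ J • F.N n) ≠ ⊤ :=
  hF.length_quotient_ne_top hq (n := max n n₀ + 1) ((hJ _ (le_max_right n n₀)).trans
    (Submodule.smul_mono le_rfl (F.antitone (le_max_left n n₀))))

/-- The Hilbert series of a good filtration of a module of almost maximal depth. -/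
theorem IsGood.exists_isHPolynomial (hq : q.radical = maximalIdeal R) (hF : F.IsGood)
    (hx : ∀ i < k + 2, (F.quotient (partialSpan x i • (⊤ : Submodule R M))).IsSuperficial (x i))
    (hreg : ∀ i < k + 1, (partialSpan x i • (⊤ : Submodule R M)).comap
        (LinearMap.lsmul R M (x i)) ≤ partialSpan x i • (⊤ : Submodule R M))
    (hs : ∃ s, q ^ s • (⊤ : Submodule R M) ≤ partialSpan x (k + 2) • (⊤ : Submodule R M))
    (hN : ∀ s, ¬ q ^ s • (⊤ : Submodule R M) ≤ partialSpan x (k + 1) • (⊤ : Submodule R M)) :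
    ∃ h U V W : ℤ[X], F.IsHPolynomial (k + 2) h ∧
      (hasseDeriv 2 h).eval 1 = (derivative V).eval 1 - (derivative W).eval 1 - U.eval 1 ∧
      (∀ n, U.coeff n = (quotLength ((partialSpan x k • (⊤ : Submodule R M) ⊔ F.N (n + 1)).comap
        (LinearMap.lsmul R M (x k))) (partialSpan x k • (⊤ : Submodule R M) ⊔ F.N n)).toNat) ∧
      (∀ n, V.coeff n = (quotLength (partialSpan x (k + 1) • (⊤ : Submodule R M) ⊔ F.N (n + 1))
        (partialSpan x (k + 1) • (⊤ : Submodule R M) ⊔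
          Ideal.span {x (k + 1)} • F.N n)).toNat) ∧
      (∀ n, 0 ≤ W.coeff n) ∧
      ((∀ n ≥ 1, W.coeff n = 0) ↔ (partialSpan x (k + 1) • (⊤ : Submodule R M)).comap
        (LinearMap.lsmul R M (x (k + 1))) ⊓ (partialSpan x (k + 1) • (⊤ : Submodule R M) ⊔ F.N 1) =
          partialSpan x (k + 1) • (⊤ : Submodule R M)) := by
  have hU : ∀ i, ∃ U : ℤ[X], i < k + 1 → ∀ n, U.coeff n =
      (quotLength ((partialSpan x i • (⊤ : Submodule R M) ⊔ F.N (n + 1)).comap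
        (LinearMap.lsmul R M (x i))) (partialSpan x i • (⊤ : Submodule R M) ⊔ F.N n)).toNat := by
    intro i
    by_cases hi : i < k + 1
    · obtain ⟨U, hU⟩ := exists_polynomial_coeff_eq_quotLength hF (hx i (by omega)) (hreg i hi)
      exact ⟨U, fun _ => hU⟩
    · exact ⟨0, fun h => absurd h hi⟩
  choose U hU using hU
  rw [partialSpan_succ_smul] at hs
  obtain ⟨e, V, W, he, hV, hW, hW', hser⟩ :=
    (hx (k + 1) (by omega)).exists_supSeries_mul_eq hq hF hs hN
  obtain ⟨T, hT, hTser⟩ := exists_mul_one_sub_X_pow_eq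
    (fun i => F.supSeries (partialSpan x i • (⊤ : Submodule R M))) U k fun i hi => by
      rw [partialSpan_succ_smul]
      exact hF.supSeries_sup hq (hx i (by omega)).1 (U i) (hU i (by omega))
  refine ⟨C e - (1 - X) * (V - W) - (1 - X) ^ 2 * T, U k, V, W, ⟨?_, ?_⟩, ?_, hU k (by omega), hV, hW,
    hW'⟩
  · rw [hF.hilbertSeries_eq hq]
    rw [partialSpan_zero, Submodule.bot_smul] at hTser
    rw [pow_succ (1 - PowerSeries.X : PowerSeries ℤ) (k + 1), ← mul_assoc, hTser,
      sub_mul (F.supSeries _), hser]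
    simp only [Polynomial.coe_mul, Polynomial.coe_sub, Polynomial.coe_one,
      Polynomial.coe_X, Polynomial.coe_C, Polynomial.coe_pow]
    ring
  · simpa using he
  · rw [hasseDeriv_two_eval_one, hT, derivative_sub, eval_sub]

end Local
end Ideal.Filtration

/-! ### Initial forms on the associated graded module -/

namespace Ideal.Filtration
variable {R : Type*} [CommRing R] {M : Type*} [AddCommGroup M] [Module R M] {q : Ideal R}
  (F : q.Filtration M)

/-- The coefficient of degree `n` of an element of the Rees module. -/
def reesCoeff (n : ℕ) : F.Rees →+ M where
  toFun f := (f.1 : PolynomialModule R M).coeff n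
  map_zero' := rfl
  map_add' _ _ := rfl

variable {F} in
theorem rees_ext {f g : F.Rees} (h : ∀ n, F.reesCoeff n f = F.reesCoeff n g) : f = g :=
  Subtype.ext (PolynomialModule.coeff_injective (Finsupp.ext h))

theorem reesCoeff_mem (n : ℕ) (f : F.Rees) : F.reesCoeff n f ∈ F.N n := f.2 n

/-- The element `m tⁿ` of the Rees module. -/
def reesSingle (n : ℕ) : F.N n →+ F.Rees where
  toFun m := ⟨PolynomialModule.single R n m, fun i => by
    rw [PolynomialModule.coeff_single, Finsupp.single_apply]
    split_ifs with h
    · exact h ▸ m.2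
    · exact zero_mem _⟩
  map_zero' := by
    apply Subtype.ext
    simp
    rfl
  map_add' m m' := by
    apply Subtype.ext
    simp [PolynomialModule.single_add]
    rfl

theorem reesCoeff_reesSingle (n i : ℕ) (m : F.N n) :
    F.reesCoeff i (F.reesSingle n m) = if n = i then (m : M) else 0 :=
  Finsupp.single_apply

theorem reesCoeff_smul (r : q.Rees) (f : F.Rees) (n : ℕ) :
    F.reesCoeff n (r • f) =
      ∑ ij ∈ _root_.Finset.HasAntidiagonal.antidiagonal n, (r.1 : R[X]).coeff ij.1 • F.reesCoeff ij.2 f :=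
  PolynomialModule.smul_apply _ _ _

/-- The quotient map from the Rees module to the associated graded module. -/
def grMk : F.Rees →+ F.Gr := F.reesShift.mkQ.toAddMonoidHom

theorem grMk_surjective : Function.Surjective F.grMk := F.reesShift.mkQ_surjective

theorem grMk_smul (r : q.Rees) (f : F.Rees) :
    F.grMk (r • f) = (Ideal.Quotient.mk _ r : q.Gr) • F.grMk f := rfl

theorem grMk_eq_zero_iff (f : F.Rees) :
    F.grMk f = 0 ↔ ∀ n, F.reesCoeff n f ∈ F.N (n + 1) :=
  Submodule.Quotient.mk_eq_zero _

theorem grMk_mem_of_forall (S : AddSubgroup F.Gr) (f : F.Rees)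
    (h : ∀ n, F.grMk (F.reesSingle n ⟨F.reesCoeff n f, F.reesCoeff_mem n f⟩) ∈ S) :
    F.grMk f ∈ S := by
  have hf : f = ∑ n ∈ (f.1 : PolynomialModule R M).coeff.support,
      F.reesSingle n ⟨F.reesCoeff n f, F.reesCoeff_mem n f⟩ := by
    refine rees_ext fun i => ?_
    rw [map_sum]
    simp only [reesCoeff_reesSingle, Finset.sum_ite_eq', Finsupp.mem_support_iff]
    split_ifs with hi
    · rfl
    · exact Finsupp.notMem_support_iff.mp hi
  rw [hf, map_sum]
  exact _root_.sum_mem fun n _ => h n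

/-- The element `a t` of the Rees ring. -/
def _root_.Ideal.reesLinear (q : Ideal R) (a : R) (ha : a ∈ q) : q.Rees :=
  ⟨monomial 1 a, reesAlgebra.monomial_mem.mpr (by rwa [pow_one])⟩

open Classical in
/-- The class of `a t` in the associated graded ring (zero unless `a ∈ q`). -/
def _root_.Ideal.grLinear (q : Ideal R) (a : R) : q.Gr :=
  if ha : a ∈ q then Ideal.Quotient.mk _ (q.reesLinear a ha) else 0

theorem grLinear_smul_grMk {a : R} (ha : a ∈ q) (f : F.Rees) :
    q.grLinear a • F.grMk f = F.grMk (q.reesLinear a ha • f) := by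
  rw [grMk_smul, Ideal.grLinear, dif_pos ha]

theorem reesCoeff_reesLinear_smul {a : R} (ha : a ∈ q) (f : F.Rees) (n : ℕ) :
    F.reesCoeff n (q.reesLinear a ha • f) = if 1 ≤ n then a • F.reesCoeff (n - 1) f else 0 :=
  PolynomialModule.monomial_smul_apply _ _ _ _

theorem reesLinear_smul_reesSingle {a : R} (ha : a ∈ q) {n : ℕ} (m : F.N n) :
    q.reesLinear a ha • F.reesSingle n m =
      F.reesSingle (n + 1) ⟨a • (m : M), F.smul_le n (Submodule.smul_mem_smul ha m.2)⟩ := by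
  refine rees_ext fun i => ?_
  rw [reesCoeff_reesLinear_smul, reesCoeff_reesSingle, reesCoeff_reesSingle]
  rcases i with _ | i
  · simp
  · simp only [Nat.le_add_left, if_true, Nat.add_sub_cancel, Nat.add_right_cancel_iff, smul_ite,
      smul_zero]

variable {F} {x : ℕ → R}

theorem reesCoeff_mem_of_grMk_mem {i : ℕ} (hxq : ∀ j < i, x j ∈ q) {f : F.Rees}
    (hf : F.grMk f ∈ partialSpan (fun j => q.grLinear (x j)) i • (⊤ : Submodule q.Gr F.Gr)) (n : ℕ) :
    F.reesCoeff n f ∈ partialSpan x i • (⊤ : Submodule R M) ⊔ F.N (n + 1) := by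
  induction i generalizing f with
  | zero =>
    rw [partialSpan_zero, Submodule.bot_smul, Submodule.mem_bot, grMk_eq_zero_iff] at hf
    exact Submodule.mem_sup_right (hf n)
  | succ i ih =>
    rw [partialSpan_succ_smul] at hf
    obtain ⟨z, hz, w, hw, hzw⟩ := Submodule.mem_sup.mp hf
    rw [Submodule.ideal_span_singleton_smul] at hw
    obtain ⟨g, -, rfl⟩ := hw
    obtain ⟨z, rfl⟩ := F.grMk_surjective z
    obtain ⟨g, rfl⟩ := F.grMk_surjective g
    have hxi := hxq i (by omega)
    change F.grMk z + q.grLinear (x i) • F.grMk g = F.grMk f at hzw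
    rw [grLinear_smul_grMk F hxi, ← sub_eq_zero, ← map_add, ← map_sub, grMk_eq_zero_iff] at hzw
    have h1 := hzw n
    have h2 := ih (fun j hj => hxq j (by omega)) hz
    rw [map_sub, map_add, reesCoeff_reesLinear_smul] at h1
    have h3 : F.reesCoeff n f = F.reesCoeff n z +
        (if 1 ≤ n then x i • F.reesCoeff (n - 1) g else 0) -
        (F.reesCoeff n z + (if 1 ≤ n then x i • F.reesCoeff (n - 1) g else 0) -
          F.reesCoeff n f) := by abel
    rw [h3, partialSpan_succ_smul]
    refine Submodule.sub_mem _ (Submodule.add_mem _ ?_ ?_) (Submodule.mem_sup_right h1)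
    · exact (sup_le_sup_right le_sup_left (F.N (n + 1)) :
        partialSpan x i • (⊤ : Submodule R M) ⊔ F.N (n + 1) ≤ _) h2
    · split_ifs
      · exact Submodule.mem_sup_left (Submodule.mem_sup_right
          (Submodule.smul_mem_smul (Ideal.mem_span_singleton_self _) trivial))
      · exact zero_mem _

theorem grMk_reesSingle_mem {i : ℕ} (hxq : ∀ j < i, x j ∈ q) {n : ℕ} (m : F.N (n + 1))
    (hm : (m : M) ∈ partialSpan x i • F.N n) :
    F.grMk (F.reesSingle (n + 1) m) ∈
      partialSpan (fun j => q.grLinear (x j)) i • (⊤ : Submodule q.Gr F.Gr) := by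
  induction i generalizing m with
  | zero =>
    rw [partialSpan_zero, Submodule.bot_smul, Submodule.mem_bot] at hm
    have : m = 0 := Subtype.ext hm
    rw [this, map_zero, map_zero]
    exact zero_mem _
  | succ i ih =>
    have hxi := hxq i (by omega)
    rw [partialSpan_succ_smul] at hm ⊢
    obtain ⟨ν, hν, w, hw, hνw⟩ := Submodule.mem_sup.mp hm
    have hν' : ν ∈ F.N (n + 1) := F.smul_le n (Submodule.smul_mono_left
      (partialSpan_le fun j hj => hxq j (by omega)) hν)
    rw [Submodule.ideal_span_singleton_smul] at hw
    obtain ⟨g, hg, rfl⟩ := hw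
    have hm' : m = ⟨ν, hν'⟩ + ⟨x i • g, F.smul_le n (Submodule.smul_mem_smul hxi hg)⟩ :=
      Subtype.ext hνw.symm
    rw [hm', map_add, map_add, ← reesLinear_smul_reesSingle F hxi ⟨g, hg⟩,
      ← grLinear_smul_grMk F hxi]
    exact Submodule.add_mem_sup (ih (fun j hj => hxq j (by omega)) _ hν)
      (Submodule.smul_mem_smul (Ideal.mem_span_singleton_self _) trivial)

/-- Identifies gr(M) modulo the initial forms of x_0, …, x_{i-1} with the graded module of M/N_i;
the colon conditions enter through the intersection property. -/
theorem grMk_mem_partialSpan_smul_top_iff (hF : F.N 0 = ⊤) {i : ℕ} (hxq : ∀ j < i, x j ∈ q)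
    (hcol : ∀ j < i, ∀ n, (partialSpan x j • (⊤ : Submodule R M) ⊔ F.N (n + 1)).comap
      (LinearMap.lsmul R M (x j)) ≤ partialSpan x j • (⊤ : Submodule R M) ⊔ F.N n) (f : F.Rees) :
    F.grMk f ∈ partialSpan (fun j => q.grLinear (x j)) i • (⊤ : Submodule q.Gr F.Gr) ↔
      ∀ n, F.reesCoeff n f ∈ partialSpan x i • (⊤ : Submodule R M) ⊔ F.N (n + 1) := by
  refine ⟨fun hf => reesCoeff_mem_of_grMk_mem hxq hf, fun hf => ?_⟩
  refine F.grMk_mem_of_forall (Submodule.toAddSubgroup (partialSpan (fun j => q.grLinear (x j)) i •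
    (⊤ : Submodule q.Gr F.Gr))) f fun n => ?_
  change _ ∈ partialSpan (fun j => q.grLinear (x j)) i • (⊤ : Submodule q.Gr F.Gr)
  obtain ⟨ν, hν, m, hm, hνm⟩ := Submodule.mem_sup.mp (hf n)
  have hm' : m ∈ F.N n := F.mono n hm
  have hν' : ν ∈ F.N n := by
    rw [← add_sub_cancel_right ν m, hνm]
    exact sub_mem (F.reesCoeff_mem n f) hm'
  have hzero : F.grMk (F.reesSingle n ⟨m, hm'⟩) = 0 := by
    rw [grMk_eq_zero_iff]
    intro j
    rw [reesCoeff_reesSingle]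
    split_ifs with h
    · exact h ▸ hm
    · exact zero_mem _
  have hsplit : (⟨F.reesCoeff n f, F.reesCoeff_mem n f⟩ : F.N n) = ⟨ν, hν'⟩ + ⟨m, hm'⟩ :=
    Subtype.ext hνm.symm
  rw [hsplit, map_add, map_add, hzero, add_zero]
  cases n with
  | zero =>
    -- In degree zero the class vanishes because N_i ⊆ qM ⊆ M_1.
    have : F.grMk (F.reesSingle 0 ⟨ν, hν'⟩) = 0 := by
      rw [grMk_eq_zero_iff]
      intro j
      rw [reesCoeff_reesSingle]
      split_ifs with h
      · rw [← h]
        have := Submodule.smul_mono_left (partialSpan_le hxq) hν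
        rw [← hF] at this
        exact F.smul_le 0 this
      · exact zero_mem _
    rw [this]
    exact zero_mem _
  | succ n =>
    exact grMk_reesSingle_mem hxq _
      (F.inf_partialSpan_smul_top_le hxq (fun j hj => hcol j hj n) ⟨hν', hν⟩)

/-- The initial forms of `x 0, …, x (n - 1)` form a weakly regular sequence on the associated
graded module if and only if `(M_{m+1} : x i) = M_m` modulo `x 0, …, x (i - 1)` for all `i < n`. -/
theorem forall_comap_grLinear_le_iff (hF : F.N 0 = ⊤) {n : ℕ} (hxq : ∀ j < n, x j ∈ q) :
    (∀ i < n, (partialSpan (fun j => q.grLinear (x j)) i • (⊤ : Submodule q.Gr F.Gr)).comap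
        (LinearMap.lsmul q.Gr F.Gr (q.grLinear (x i))) ≤
          partialSpan (fun j => q.grLinear (x j)) i • (⊤ : Submodule q.Gr F.Gr)) ↔
      ∀ i < n, ∀ m, (partialSpan x i • (⊤ : Submodule R M) ⊔ F.N (m + 1)).comap
        (LinearMap.lsmul R M (x i)) ≤ partialSpan x i • (⊤ : Submodule R M) ⊔ F.N m := by
  induction n with
  | zero => simp
  | succ n ih =>
    have ih := ih fun j hj => hxq j (by omega)
    have hxn := hxq n (by omega)
    simp only [Nat.lt_succ_iff_lt_or_eq, or_imp, forall_and, forall_eq]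
    rw [ih]
    refine and_congr_right fun hcol => ?_
    have hiff := grMk_mem_partialSpan_smul_top_iff hF (fun j hj => hxq j (by omega)) hcol
    constructor
    · intro hreg m y hy
      change x n • y ∈ _ ⊔ F.N (m + 1) at hy
      -- Regularity of the initial form improves the degree of y by one at a time, starting from M_0
      -- = M.
      suffices key : ∀ l ≤ m, y ∈ partialSpan x n • (⊤ : Submodule R M) ⊔ F.N l from key m le_rfl
      intro l
      induction l with
      | zero => intro _; simp [hF]
      | succ l ihl =>
        intro hl
        obtain ⟨ν, hν, g, hg, rfl⟩ := Submodule.mem_sup.mp (ihl (by omega))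
        refine add_mem (Submodule.mem_sup_left hν) ?_
        have hxg : x n • g ∈ partialSpan x n • (⊤ : Submodule R M) ⊔ F.N (l + 1 + 1) := by
          rw [smul_add] at hy
          exact (sup_le_sup_left (F.antitone (by omega)) _ : _ ≤ _)
            ((Submodule.add_mem_iff_right _ (Submodule.mem_sup_left
              (Submodule.smul_mem _ _ hν))).mp hy)
        have h1 : F.grMk (F.reesSingle l ⟨g, hg⟩) ∈
            partialSpan (fun j => q.grLinear (x j)) n • (⊤ : Submodule q.Gr F.Gr) := by
          refine hreg ?_
          change q.grLinear (x n) • F.grMk _ ∈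
            partialSpan (fun j => q.grLinear (x j)) n • (⊤ : Submodule q.Gr F.Gr)
          rw [grLinear_smul_grMk F hxn, reesLinear_smul_reesSingle, hiff]
          intro j
          rw [reesCoeff_reesSingle]
          split_ifs with h
          · exact h ▸ hxg
          · exact zero_mem _
        have h2 := (hiff _).mp h1 l
        rwa [reesCoeff_reesSingle, if_pos rfl] at h2
    · intro hcoln z hz
      obtain ⟨f, rfl⟩ := F.grMk_surjective z
      change q.grLinear (x n) • F.grMk f ∈
        partialSpan (fun j => q.grLinear (x j)) n • (⊤ : Submodule q.Gr F.Gr) at hz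
      rw [grLinear_smul_grMk F hxn, hiff] at hz
      rw [hiff]
      intro m
      have := hz (m + 1)
      rw [reesCoeff_reesLinear_smul, if_pos (by omega), Nat.add_sub_cancel] at this
      exact hcoln (m + 1) this

end Ideal.Filtration

/-! ### Depth of the associated graded module -/

namespace Ideal.Filtration
variable {R : Type*} [CommRing R] {M : Type*} [AddCommGroup M] [Module R M] {q : Ideal R}
  {F : q.Filtration M} {x : ℕ → R}

instance [IsNoetherianRing R] (q : Ideal R) : IsNoetherianRing q.Rees :=
  inferInstanceAs (IsNoetherianRing (reesAlgebra q))

theorem IsGood.finite_gr [IsNoetherianRing R] [Module.Finite R M] (hF : F.IsGood) :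
    Module.Finite q.Gr F.Gr := by
  have hfg : Module.Finite (reesAlgebra q) F.submodule := Module.Finite.iff_fg.mpr
    ((F.submodule_fg_iff_stable fun _ => IsNoetherian.noetherian _).mpr hF.stable)
  have : Module.Finite q.Rees F.Rees := hfg
  have : IsScalarTower q.Rees q.Gr F.Gr := ⟨fun r s z => by
    obtain ⟨s, rfl⟩ := Ideal.Quotient.mk_surjective s
    obtain ⟨f, rfl⟩ := F.grMk_surjective z
    change (Ideal.Quotient.mk _ (r * s) : q.Gr) • F.grMk f = F.reesShift.mkQ (r • s • f)
    rw [← grMk_smul, mul_smul]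
    rfl⟩
  exact Module.Finite.of_restrictScalars_finite q.Rees q.Gr F.Gr

/-- The constant term of r moves M_n into M_{n+1}, and the higher terms only see coefficients of f
of degree below t. Iterating, r^t kills every degree below t. -/
theorem reesCoeff_smul_mem_sup {N : Submodule R M} {r : q.Rees} (hr : (r.1 : R[X]).coeff 0 ∈ q)
    {f : F.Rees} {t : ℕ} (hf : ∀ n < t, F.reesCoeff n f ∈ N ⊔ F.N (n + 1)) {n : ℕ}
    (hn : n < t + 1) : F.reesCoeff n (r • f) ∈ N ⊔ F.N (n + 1) := by
  rw [reesCoeff_smul]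
  refine _root_.sum_mem fun ij hij => ?_
  rw [_root_.Finset.HasAntidiagonal.mem_antidiagonal] at hij
  obtain ⟨i, j⟩ := ij
  dsimp only at hij ⊢
  subst hij
  have hri : (r.1 : R[X]).coeff i ∈ q ^ i := r.2 i
  rcases i with _ | i
  · rw [zero_add]
    exact Submodule.mem_sup_right
      (F.smul_le j (Submodule.smul_mem_smul hr (F.reesCoeff_mem j f)))
  · obtain ⟨ν, hν, m, hm, h⟩ := Submodule.mem_sup.mp (hf j (by omega))
    rw [← h, smul_add]
    exact Submodule.add_mem_sup (Submodule.smul_mem _ _ hν)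
      (F.pow_smul_le (i + 1) (j + 1) (Submodule.smul_mem_smul hri hm))

theorem reesCoeff_pow_smul_mem_sup {N : Submodule R M} {r : q.Rees}
    (hr : (r.1 : R[X]).coeff 0 ∈ q) (f : F.Rees) (t : ℕ) :
    ∀ n < t, F.reesCoeff n (r ^ t • f) ∈ N ⊔ F.N (n + 1) := by
  induction t with
  | zero => intro n hn; omega
  | succ t ih =>
    intro n hn
    rw [pow_succ', mul_smul]
    exact reesCoeff_smul_mem_sup hr ih hn

section Local
variable [IsLocalRing R]

theorem mem_grMaximalIdeal_iff (y : q.Gr) :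
    y ∈ q.grMaximalIdeal ↔ ∃ r : q.Rees, (r.1 : R[X]).coeff 0 ∈ maximalIdeal R ∧
      Ideal.Quotient.mk _ r = y :=
  Ideal.mem_map_iff_of_surjective _ Ideal.Quotient.mk_surjective

theorem grLinear_mem_grMaximalIdeal {a : R} (ha : a ∈ q) : q.grLinear a ∈ q.grMaximalIdeal := by
  rw [mem_grMaximalIdeal_iff]
  refine ⟨q.reesLinear a ha, ?_, ?_⟩
  · change (monomial 1 a : R[X]).coeff 0 ∈ maximalIdeal R
    simp
  · rw [Ideal.grLinear, dif_pos ha]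

theorem reesCoeff_mem_of_grMk_mem_grMaximalIdeal_smul (hqm : q ≤ maximalIdeal R) {f : F.Rees}
    (hf : F.grMk f ∈ q.grMaximalIdeal • (⊤ : Submodule q.Gr F.Gr)) (n : ℕ) :
    F.reesCoeff n f ∈ F.N (n + 1) ⊔ maximalIdeal R • (⊤ : Submodule R M) := by
  suffices key : ∀ z ∈ q.grMaximalIdeal • (⊤ : Submodule q.Gr F.Gr), ∃ g : F.Rees,
      F.grMk g = z ∧ F.reesCoeff n g ∈ maximalIdeal R • (⊤ : Submodule R M) by
    obtain ⟨g, hg, hgn⟩ := key _ hf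
    rw [← sub_add_cancel f g, map_add]
    refine Submodule.add_mem_sup ((F.grMk_eq_zero_iff _).mp ?_ n) hgn
    rw [map_sub, hg, sub_self]
  intro z hz
  induction hz using Submodule.smul_induction_on' with
  | smul y hy z _ =>
    obtain ⟨r, hr, rfl⟩ := (mem_grMaximalIdeal_iff y).mp hy
    obtain ⟨g, rfl⟩ := F.grMk_surjective z
    refine ⟨r • g, F.grMk_smul r g, ?_⟩
    rw [reesCoeff_smul]
    refine _root_.sum_mem fun ij _ => Submodule.smul_mem_smul ?_ trivial
    have hri : (r.1 : R[X]).coeff ij.1 ∈ q ^ ij.1 := r.2 ij.1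
    rcases ij with ⟨_ | i, j⟩
    · exact hr
    · exact hqm (Ideal.pow_le_self (Nat.succ_ne_zero i) hri)
  | add z _ w _ hz hw =>
    obtain ⟨g, rfl, hg⟩ := hz
    obtain ⟨g', rfl, hg'⟩ := hw
    exact ⟨g + g', map_add _ _ _, by rw [map_add]; exact add_mem hg hg'⟩

variable [IsNoetherianRing R] [Module.Finite R M]

/-- Otherwise M = M_{n+1} + 𝔪M whenever M_n = M, so Nakayama gives M_n = M for all n, contradicting
Krull's theorem. -/
theorem IsGood.grMaximalIdeal_smul_top_ne_top [Nontrivial M] (hqm : q ≤ maximalIdeal R)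
    (hF : F.IsGood) : q.grMaximalIdeal • (⊤ : Submodule q.Gr F.Gr) ≠ ⊤ := by
  have hq' : q ≠ ⊤ := fun h => (maximalIdeal.isMaximal R).ne_top (top_le_iff.mp (h ▸ hqm))
  intro htop
  suffices key : ∀ n, F.N n = ⊤ by
    obtain ⟨m, hm⟩ := exists_ne (0 : M)
    exact hm ((Submodule.mem_bot R).mp (hF.mem_of_forall_mem_sup hq' fun n => by simp [key n]))
  intro n
  induction n with
  | zero => exact hF.zero_eq_top
  | succ n ih =>
    refine top_le_iff.mp (Submodule.le_of_le_smul_of_le_jacobson_bot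
      (IsNoetherian.noetherian (⊤ : Submodule R M)) (maximalIdeal_le_jacobson _) fun m _ => ?_)
    have hm : m ∈ F.N n := ih ▸ trivial
    have := reesCoeff_mem_of_grMk_mem_grMaximalIdeal_smul hqm
      (f := F.reesSingle n ⟨m, hm⟩) (by rw [htop]; exact Submodule.mem_top) n
    rwa [reesCoeff_reesSingle, if_pos rfl] at this

theorem IsGood.le_grDepth_iff [Nontrivial M] (hq : q.radical = maximalIdeal R) (hF : F.IsGood)
    {n : ℕ}
    (hx : ∀ i < n, (F.quotient (partialSpan x i • (⊤ : Submodule R M))).IsSuperficial (x i)) :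
    (n : ℕ∞) ≤ F.grDepth ↔ ∀ i < n, ∀ m,
      (partialSpan x i • (⊤ : Submodule R M) ⊔ F.N (m + 1)).comap (LinearMap.lsmul R M (x i)) ≤
        partialSpan x i • (⊤ : Submodule R M) ⊔ F.N m := by
  have hqm : q ≤ maximalIdeal R := hq ▸ Ideal.le_radical
  have hfin := hF.finite_gr
  have hne := hF.grMaximalIdeal_smul_top_ne_top hqm
  have hxq : ∀ j < n, x j ∈ q := fun j hj => (hx j hj).1
  rw [← forall_comap_grLinear_le_iff hF.zero_eq_top hxq]
  constructor
  · intro hn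
    refine _root_.comap_partialSpan_smul_top_le (x := fun j => q.grLinear (x j)) hne hn
      (fun i hi => grLinear_mem_grMaximalIdeal (hxq i hi)) fun i hi hreg => ?_
    have hcol := (forall_comap_grLinear_le_iff hF.zero_eq_top
      fun j hj => hxq j (hj.trans hi)).mp hreg
    have hiff := grMk_mem_partialSpan_smul_top_iff hF.zero_eq_top
      (fun j hj => hxq j (hj.trans hi)) hcol
    obtain ⟨c, hc⟩ := (hx i hi).comap_inf_sup
    obtain ⟨k, hk⟩ := Ideal.exists_pow_le_of_le_radical_of_fg hq.ge
      (IsNoetherian.noetherian (maximalIdeal R))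
    -- The power r^k has constant term in q; a further c-th power clears the degrees below c, and
    -- superficiality handles the degrees from c on.
    refine ⟨k * c, fun y hy z hz => ?_⟩
    obtain ⟨r, hr, rfl⟩ := (mem_grMaximalIdeal_iff y).mp hy
    obtain ⟨f, rfl⟩ := F.grMk_surjective z
    have hrk : ((r ^ k).1 : R[X]).coeff 0 ∈ q := by
      have : ((r ^ k).1 : R[X]).coeff 0 = (r.1 : R[X]).coeff 0 ^ k :=
        map_pow q.reesConstantCoeff r k
      rw [this]
      exact hk (Ideal.pow_mem_pow hr k)
    rw [pow_mul, ← map_pow, ← map_pow, ← grMk_smul, hiff]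
    have hz' : q.grLinear (x i) • F.grMk ((r ^ k) ^ c • f) ∈
        partialSpan (fun j => q.grLinear (x j)) i • (⊤ : Submodule q.Gr F.Gr) := by
      rw [grMk_smul, smul_comm]
      exact Submodule.smul_mem _ _ hz
    rw [grLinear_smul_grMk F (hxq i hi), hiff] at hz'
    intro m
    rcases lt_or_ge m c with hm | hm
    · exact reesCoeff_pow_smul_mem_sup hrk f c m hm
    · have h1 := hz' (m + 1)
      rw [reesCoeff_reesLinear_smul, if_pos (by omega), Nat.add_sub_cancel] at h1
      rw [← hc (m + 1) (by omega)]
      exact ⟨h1, Submodule.mem_sup_right (F.antitone hm (F.reesCoeff_mem m _))⟩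
  · intro hreg
    have hmem : ∀ y ∈ (List.range n).map fun j => q.grLinear (x j), y ∈ q.grMaximalIdeal := by
      intro y hy
      obtain ⟨j, hj, rfl⟩ := List.mem_map.mp hy
      exact grLinear_mem_grMaximalIdeal (hxq j (List.mem_range.mp hj))
    have hR : RingTheory.Sequence.IsRegular F.Gr
        ((List.range n).map fun j => q.grLinear (x j)) :=
      ⟨(isWeaklyRegular_map_range_iff _ n).mpr hreg, fun htop => hne (top_le_iff.mp
        (htop.le.trans (Submodule.smul_mono_left (Ideal.span_le.mpr hmem))))⟩
    have hlen : (((List.range n).map fun j => q.grLinear (x j)).length : ℕ∞) ≤ F.grDepth :=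
      le_iSup (fun rs : {rs : List q.Gr // RingTheory.Sequence.IsRegular F.Gr rs ∧
      ∀ r ∈ rs, r ∈ q.grMaximalIdeal} => (rs.1.length : ℕ∞)) ⟨_, hR, hmem⟩
    rwa [List.length_map, List.length_range] at hlen

end Local
end Ideal.Filtration

/-! ### The inequality and the equality case -/

namespace Ideal.Filtration
variable {R : Type*} [CommRing R] {M : Type*} [AddCommGroup M] [Module R M] {q : Ideal R}
  {F : q.Filtration M} {x : ℕ → R} {k : ℕ}

/-- Sally's descent along a superficial sequence. -/
theorem comap_partialSpan_sup_le_of_last (hF : F.N 0 = ⊤)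
    (hx : ∀ i < k + 1, (F.quotient (partialSpan x i • (⊤ : Submodule R M))).IsSuperficial (x i))
    (h : ∀ n, (partialSpan x k • (⊤ : Submodule R M) ⊔ F.N (n + 1)).comap
      (LinearMap.lsmul R M (x k)) ≤ partialSpan x k • (⊤ : Submodule R M) ⊔ F.N n) :
    ∀ i < k + 1, ∀ n, (partialSpan x i • (⊤ : Submodule R M) ⊔ F.N (n + 1)).comap
      (LinearMap.lsmul R M (x i)) ≤ partialSpan x i • (⊤ : Submodule R M) ⊔ F.N n := by
  suffices key : ∀ t i, i + t = k →
      ∀ n, (partialSpan x i • (⊤ : Submodule R M) ⊔ F.N (n + 1)).comap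
      (LinearMap.lsmul R M (x i)) ≤ partialSpan x i • (⊤ : Submodule R M) ⊔ F.N n from
    fun i hi => key (k - i) i (by omega)
  intro t
  induction t with
  | zero => rintro i rfl; exact h
  | succ t ih =>
    intro i hi
    refine (hx i (by omega)).comap_le_of_comap_le hF (hx (i + 1) (by omega)).1 ?_
    rw [← partialSpan_succ_smul]
    exact ih (i + 1) (by omega)

variable [IsLocalRing R] [IsNoetherianRing R] [Module.Finite R M]

theorem IsGood.hilbertCoeff_two_le_sum (hq : q.radical = maximalIdeal R) (hF : F.IsGood)
    (hdim : Module.supportDim R M = (k + 2 : ℕ))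
    (hdepth : ((k + 1 : ℕ) : ℕ∞) ≤ moduleDepth (maximalIdeal R) M)
    (hx : ∀ i < k + 2, (F.quotient (partialSpan x i • (⊤ : Submodule R M))).IsSuperficial (x i)) :
    (∃! h, F.IsHPolynomial (k + 2) h) ∧
    ∃ S : ℕ, HasSum (fun n : ℕ => (n : ℕ∞) *
        quotLength (F.N (n + 1)) (partialSpan x (k + 2) • F.N n)) (S : ℕ∞) ∧
      F.hilbertCoeff (k + 2) 2 ≤ S ∧
      (F.hilbertCoeff (k + 2) 2 = S ↔ ((k + 1 : ℕ) : ℕ∞) ≤ F.grDepth ∧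
        (partialSpan x (k + 1) • (⊤ : Submodule R M)).comap (LinearMap.lsmul R M (x (k + 1))) ⊓
          F.N 1 = partialSpan x (k + 1) • (⊤ : Submodule R M)) := by
  have hqm : q ≤ maximalIdeal R := hq ▸ Ideal.le_radical
  have hM : Nontrivial M := by
    rw [← Module.supportDim_ne_bot_iff_nontrivial R, hdim]
    exact WithBot.coe_ne_bot
  have hxq : ∀ i < k + 2, x i ∈ q := fun i hi => (hx i hi).1
  have hreg := hF.comap_partialSpan_smul_top_le hq hdepth fun i hi => hx i (by omega)
  have hdimN : Module.supportDim R (M ⧸ partialSpan x (k + 1) • (⊤ : Submodule R M)) = 1 := by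
    have h := supportDim_quotient_partialSpan (fun i hi => hqm (hxq i (by omega))) hreg
    rw [hdim] at h
    generalize Module.supportDim R (M ⧸ partialSpan x (k + 1) • (⊤ : Submodule R M)) = D at h
    induction D with
    | bot => exact absurd h.symm WithBot.coe_ne_bot
    | coe D =>
      norm_cast at h ⊢
      have h' : D + ((k + 1 : ℕ) : ℕ∞) = 1 + ((k + 1 : ℕ) : ℕ∞) := by
        have h'' : D + ((k + 1 : ℕ) : ℕ∞) = ((k + 2 : ℕ) : ℕ∞) := WithBot.coe_injective h
        rw [h'']
        push_cast
        ring
      exact WithTop.add_right_cancel (ENat.natCast_ne_top _) h'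
  have hs : ∃ s, q ^ s • (⊤ : Submodule R M) ≤ partialSpan x (k + 2) • (⊤ : Submodule R M) := by
    rw [partialSpan_succ_smul]
    exact (hx (k + 1) (by omega)).exists_pow_smul_top_le hq hF hdimN
  have hN : ∀ s, ¬ q ^ s • (⊤ : Submodule R M) ≤ partialSpan x (k + 1) • (⊤ : Submodule R M) := by
    intro s hs
    have := supportDim_quotient_le_zero hq hs
    rw [hdimN] at this
    exact absurd this (by decide)
  obtain ⟨h, U, V, W, hh, hcoeff, hU, hV, hW, hW'⟩ := hF.exists_isHPolynomial hq hx hreg hs hN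
  obtain ⟨n₀, hn₀⟩ := hF.exists_le_partialSpan_smul (k := k + 1) hx hreg hs
  have hJle : ∀ n, partialSpan x (k + 2) • F.N n ≤ F.N (n + 1) := fun n =>
    (Submodule.smul_mono_left (partialSpan_le hxq)).trans (F.smul_le n)
  have hfin : ∀ n, quotLength (F.N (n + 1)) (partialSpan x (k + 2) • F.N n) ≠ ⊤ := fun n =>
    ne_top_of_le_ne_top (hF.length_quotient_smul_ne_top hq hn₀ n)
      (quotLength_le_length_quotient (hJle n))
  have hzero : ∀ n ≥ n₀, quotLength (F.N (n + 1)) (partialSpan x (k + 2) • F.N n) = 0 :=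
    fun n hn => (quotLength_eq_zero_iff (hJle n)).mpr (le_antisymm (hn₀ n hn) (hJle n))
  obtain ⟨T, hT⟩ := exists_polynomial_coeff (fun n =>
    ((quotLength (F.N (n + 1)) (partialSpan x (k + 2) • F.N n)).toNat : ℤ)) n₀ fun n hn => by
      rw [hzero n hn]; rfl
  have hVeq : ∀ n, quotLength (partialSpan x (k + 1) • (⊤ : Submodule R M) ⊔ F.N (n + 1))
      (partialSpan x (k + 1) • (⊤ : Submodule R M) ⊔ Ideal.span {x (k + 1)} • F.N n) =
      quotLength (F.N (n + 1)) (F.N (n + 1) ⊓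
        (partialSpan x (k + 1) • (⊤ : Submodule R M) ⊔ Ideal.span {x (k + 1)} • F.N n)) :=
    quotLength_partialSpan_eq hxq
  have hVT : ∀ n, 0 ≤ (T - V).coeff n := by
    intro n
    rw [coeff_sub, sub_nonneg, hV, hT, hVeq]
    exact_mod_cast ENat.toNat_le_toNat (quotLength_anti (partialSpan_smul_le_inf hxq n)) (hfin n)
  have hU0 : ∀ n, 0 ≤ U.coeff n := fun n => by rw [hU]; positivity
  have hS : ((∑ n ∈ Finset.range n₀,
      n * (quotLength (F.N (n + 1)) (partialSpan x (k + 2) • F.N n)).toNat : ℕ) : ℤ) =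
        (derivative T).eval 1 := by
    rw [derivative_eval_one_eq_sum (B := n₀) fun n hn => by rw [hT, hzero n hn]; rfl]
    push_cast
    exact Finset.sum_congr rfl fun n _ => by rw [hT]
  -- The gap is an exact sum of three terms, each nonnegative.
  have hdiff : ((∑ n ∈ Finset.range n₀,
      n * (quotLength (F.N (n + 1)) (partialSpan x (k + 2) • F.N n)).toNat : ℕ) : ℤ) -
        F.hilbertCoeff (k + 2) 2 =
      (derivative (T - V)).eval 1 + (derivative W).eval 1 + U.eval 1 := by
    rw [hS, hh.hilbertCoeff_eq, hcoeff, derivative_sub, eval_sub]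
    ring
  have h1 := eval_one_nonneg (coeff_derivative_nonneg fun n _ => hVT n)
  have h2 := eval_one_nonneg (coeff_derivative_nonneg fun n _ => hW n)
  have h3 := eval_one_nonneg hU0
  -- N ⊆ qM ⊆ M_1 turns the criterion for W into the stated condition. The coefficient W_0 does not
  -- matter, as the derivative ignores it.
  have hN1 : partialSpan x (k + 1) • (⊤ : Submodule R M) ⊔ F.N 1 = F.N 1 := by
    refine sup_eq_right.mpr ((Submodule.smul_mono_left
      (partialSpan_le fun i hi => hxq i (by omega))).trans ?_)
    rw [← hF.zero_eq_top]
    exact F.smul_le 0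
  rw [hN1] at hW'
  refine ⟨⟨h, hh, fun h' hh' => hh'.unique hh⟩, _, ?_, by linarith, ?_⟩
  · have hsum : HasSum (fun n : ℕ => (n : ℕ∞) *
        quotLength (F.N (n + 1)) (partialSpan x (k + 2) • F.N n)) (∑ n ∈ Finset.range n₀, (n : ℕ∞) *
          quotLength (F.N (n + 1)) (partialSpan x (k + 2) • F.N n)) :=
      hasSum_sum_of_ne_finset_zero fun n hn => by
        rw [hzero n (by simpa using hn), mul_zero]
    rw [Nat.cast_sum, Finset.sum_congr rfl fun n _ => ?_]
    · exact hsum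
    · rw [Nat.cast_mul, ENat.natCast_toNat (hfin n)]
  · rw [hF.le_grDepth_iff hq fun i hi => hx i (by omega), ← hW']
    constructor
    · intro heq
      have hU1 : U.eval 1 = 0 := by linarith
      have hW1 : (derivative W).eval 1 = 0 := by linarith
      refine ⟨comap_partialSpan_sup_le_of_last hF.zero_eq_top (fun i hi => hx i (by omega))
        fun n => ?_, (derivative_eval_one_eq_zero_iff fun n _ => hW n).mp hW1⟩
      have hle : partialSpan x k • (⊤ : Submodule R M) ⊔ F.N n ≤
          (partialSpan x k • (⊤ : Submodule R M) ⊔ F.N (n + 1)).comap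
            (LinearMap.lsmul R M (x k)) := fun m hm => F.smul_mem_sup _ (hxq k (by omega)) hm
      have hUn := (eval_one_eq_zero_iff hU0).mp hU1 n
      rw [hU] at hUn
      refine ((quotLength_eq_zero_iff hle).mp (ENat.toNat_eq_zero.mp
        (by exact_mod_cast hUn) |>.resolve_right ?_)).le
      exact ne_top_of_le_ne_top (hF.length_quotient_ne_top hq le_sup_right)
        (quotLength_le_length_quotient hle)
    · rintro ⟨hcol, hW0⟩
      have hW1 := (derivative_eval_one_eq_zero_iff fun n _ => hW n).mpr hW0
      have hU1 : U.eval 1 = 0 := by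
        rw [eval_one_eq_zero_iff hU0]
        intro n
        have hle : partialSpan x k • (⊤ : Submodule R M) ⊔ F.N n ≤
            (partialSpan x k • (⊤ : Submodule R M) ⊔ F.N (n + 1)).comap
              (LinearMap.lsmul R M (x k)) := fun m hm => F.smul_mem_sup _ (hxq k (by omega)) hm
        rw [hU, (quotLength_eq_zero_iff hle).mpr (le_antisymm (hcol k (by omega) n) hle)]
        rfl
      -- The colon conditions give M_{n+1} ∩ (N + bM_n) = JM_n, hence V = T.
      have hV1 : (derivative (T - V)).eval 1 = 0 := by
        rw [derivative_eval_one_eq_zero_iff fun n _ => hVT n]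
        intro n _
        rw [coeff_sub, hV, hT, hVeq, le_antisymm (inf_le_partialSpan_smul hxq
          fun j hj => hcol j hj n) (partialSpan_smul_le_inf hxq n), sub_self]
      linarith

end Ideal.Filtration
end

theorem theorem1 {R : Type*} [CommRing R] [IsLocalRing R] [IsNoetherianRing R]
    {M : Type*} [AddCommGroup M] [Module R M] [Module.Finite R M]
    (q : Ideal R) (hq : q.radical = maximalIdeal R)
    (F : q.Filtration M) (hF : F.IsGood)
    (d : ℕ) (hd : 2 ≤ d) (hdim : Module.supportDim R M = d)
    (hdepth : ((d - 1 : ℕ) : ℕ∞) ≤ moduleDepth (maximalIdeal R) M)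
    (a : Fin d → R) (ha : F.IsSuperficialSeq a)
    (J J₁ : Ideal R) (hJ : J = Ideal.span (Set.range a))
    (hJ₁ : J₁ = Ideal.span (a '' {j | (j : ℕ) < d - 1})) :
    -- the Hilbert function is finite and the `h`-polynomial exists
    (∀ n, F.hilbertFunction n ≠ ⊤) ∧ (∃! h, F.IsHPolynomial d h) ∧
    -- the sum `S` of `n * λ(M_{n+1} / J M_n)` over `n ≥ 1` (the term at `n = 0` vanishes) is finite
    ∃ S : ℕ, HasSum (fun n : ℕ => (n : ℕ∞) * quotLength (F.N (n + 1)) (J • F.N n)) (S : ℕ∞) ∧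
      F.hilbertCoeff d 2 ≤ S ∧
      (F.hilbertCoeff d 2 = S ↔
        ((d - 1 : ℕ) : ℕ∞) ≤ F.grDepth ∧
        (J₁ • (⊤ : Submodule R M)).comap (LinearMap.lsmul R M (a ⟨d - 1, by omega⟩)) ⊓ F.N 1
          = J₁ • (⊤ : Submodule R M)) := by
  obtain ⟨k, rfl⟩ : ∃ k, d = k + 2 := ⟨d - 2, by omega⟩
  -- The values from k + 2 on are irrelevant padding.
  let x : ℕ → R := fun i => if h : i < k + 2 then a ⟨i, h⟩ else 0
  have hxa : ∀ i (h : i < k + 2), x i = a ⟨i, h⟩ := fun i h => dif_pos h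
  have hspan : ∀ i ≤ k + 2, Ideal.span (a '' {j | (j : ℕ) < i}) = partialSpan x i := by
    intro i hi
    rw [partialSpan]
    congr 1
    ext y
    constructor
    · rintro ⟨j, hj, rfl⟩
      exact ⟨j, hj, hxa j j.2⟩
    · rintro ⟨j, hj, rfl⟩
      exact ⟨⟨j, lt_of_lt_of_le hj hi⟩, hj, (hxa j _).symm⟩
  have hJx : J = partialSpan x (k + 2) := by
    rw [hJ, ← hspan _ le_rfl, ← Set.image_univ]
    congr 2
    ext j
    simp
  have hJ₁x : J₁ = partialSpan x (k + 1) := by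
    rw [hJ₁, ← hspan _ (by omega)]
    rfl
  have hx : ∀ i < k + 2,
      (F.quotient (partialSpan x i • (⊤ : Submodule R M))).IsSuperficial (x i) := by
    intro i hi
    rw [hxa i hi, ← hspan i hi.le]
    exact ha ⟨i, hi⟩
  have hlast : a ⟨k + 2 - 1, by omega⟩ = x (k + 1) := (hxa (k + 1) (by omega)).symm
  rw [hlast, hJx, hJ₁x]
  refine ⟨fun n => ?_, hF.hilbertCoeff_two_le_sum hq hdim hdepth hx⟩
  exact ne_top_of_le_ne_top (hF.length_quotient_ne_top hq le_rfl)
    (quotLength_le_length_quotient (F.mono n))
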